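/- **Notation.** Let $\mathcal M$ be the algebra of meromorphic functions on $\mathbb C^n$ (coordinates $x_1,\dots,x_n$), and let $s_{ij}$ exchange the $i$-th and $j$-th coordinates. For $a\in\mathbb C$ and meromorphic functions $\psi_{ij}$ on $\mathbb C$ ($1\le i\neq j\le n$), let $\tilde{\mathcal E}_n(\psi_{ij})$ be the $\mathbb C$-algebra generated by $\mathcal M$ and symbols $\langle ij\rangle=-\langle ji\rangle$ with the relations - $\langle ij\rangle^2=\psi_{ij}(x_i-x_j)$; - $\langle ij\rangle\langle kl\rangle=\langle kl\rangle\langle ij\rangle$ if $\{i,j\}\cap\{k,l\}=\emptyset$; - $\langle ij\rangle\langle jk\rangle+\langle jk\rangle\langle ki\rangle+\langle ki\rangle\langle ij\rangle=0$ for distinct $i,j,k$; - $[ij]\,f(\xi)=f(s_{ij}\xi)\,[ij]$ for $f\in\mathcal M$, where $[ij]:=\langle ij\rangle-\frac{a}{x_i-x_j}$. For a commutative ring $R$ and $p_{ij}=p_{ji}\in R$ let $\mathcal E_n^p$ be the $R$-algebra generated by symbols $[ij]=-[ji]$ ($i\ne j$) with the relations $[ij]^2=p_{ij}$, $[ij][kl]=[kl][ij]$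 if $\{i,j\}\cap\{k,l\}=\emptyset$, and $[ij][jk]+[jk][ki]+[ki][ij]=0$ for distinct $i,j,k$. In either algebra put $\theta_i=\sum_{j\ne i}[ij]$. The $p$-deformed elementary symmetric polynomials $E_k(I)=E_k(X_i,\,i\in I;\,p)$ are defined by $E_0(I)=1$, $E_k(\emptyset)=0$ for $k\geq 1$, $E_{-1}=0$ and, for $k\ge1$ and $j\notin I$, $$E_k(I\cup\{j\})=E_k(I)+E_{k-1}(I)X_j+\sum_{i\in I}p_{ij}E_{k-2}(I\setminus\{i\}).$$ **Proposition 4.2.** (1) Let $a,\kappa\in\mathbb C$, let $\Lambda_1,\dots,\Lambda_n\in\mathbb C$ be distinct, and put $A=a^2$, $\Lambda_{ij}=\Lambda_i-\Lambda_j$, $p_{ij}=\kappa\Lambda_{ij}^{-2}$. Consider the rational solution $$\psi_{ij}(z)=\frac{A-K}{z^2}+\frac{K}{\lambda_{ij}^2},\qquad \lambda_{ij}=\lambda_i-\lambda_j,$$ with $K=\kappa\delta^2$ and $\lambda_{i}=\delta\Lambda_{i}$. For $z\neq0$ and $i\ne j$, $$\lim_{\delta\to0}\psi_{ij}(z)=\psi^0_{ij}(z):=\frac{A}{z^2}+p_{ij}.$$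 In the limit algebra $\tilde{\mathcal E}_n(\psi^0_{ij})$ one has $[ij]^2=p_{ij}$ for $i\ne j$; the $\mathbb C$-subalgebra generated by the $[ij]$ is isomorphic, via $[ij]\mapsto[ij]$, to $\mathcal E_n^p$ (over $R=\mathbb C$); the elements $\theta_1,\dots,\theta_n$ commute pairwise; and for all $I\subset\{1,\dots,n\}$ and $k\ge0$ $$E_k(\theta_i,\,i\in I;\,p)=\sum [a_1b_1][a_2b_2]\cdots[a_kb_k],\qquad(*)$$ where the sum is over all $(a_1,\dots,a_k)$ and $(b_1,\dots,b_k)$ such that $a_1,\dots,a_k\in I$ are distinct, $b_1,\dots,b_k\in\{1,\dots,n\}\setminus I$ and $b_1\le\cdots\le b_k$. (2) (The Fomin–Kirillov conjecture, proved by Postnikov.) For every commutative ring $R$ and all parameters $p_{ij}=p_{ji}\in R$, the elements $\theta_1,\dots,\theta_n$ of $\mathcal E_n^p$ commute pairwise, and $(*)$ holds in $\mathcal E_n^p$ for all $I$ and $k$. -/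

import Mathlib

open Filter Topology

noncomputable section

namespace DeformedFK

/-! ### Meromorphic functions on `ℂ` and on `ℂⁿ` -/

/-- Meromorphic functions on `ℂ`, represented by functions `ℂ → ℂ` that are meromorphic at every
point (the values at poles are irrelevant). -/
abbrev Mero₁ : Type := {f : ℂ → ℂ // ∀ z, MeromorphicAt f z}

/-- `f : ℂⁿ → ℂ` represents a meromorphic function: near every point, `f = g / h` away from the
zeros of `h`, with `g`, `h` holomorphic and `h` not vanishing identically on any open set. -/
def IsMero {n : ℕ} (f : (Fin n → ℂ) → ℂ) : Prop :=
  ∀ z, ∃ U : Set (Fin n → ℂ), IsOpen U ∧ z ∈ U ∧ ∃ g h : (Fin n → ℂ) → ℂ,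
    DifferentiableOn ℂ g U ∧ DifferentiableOn ℂ h U ∧ U ⊆ closure {y ∈ U | h y ≠ 0} ∧
      ∀ y ∈ U, h y ≠ 0 → f y = g y / h y

theorem IsMero.of_differentiable {n : ℕ} {f : (Fin n → ℂ) → ℂ} (hf : Differentiable ℂ f) :
    IsMero f := fun z =>
  ⟨Set.univ, isOpen_univ, Set.mem_univ z, f, fun _ => 1, hf.differentiableOn,
    differentiableOn_const _, by simp, fun y _ _ => by simp⟩

theorem subset_closure_mul {n : ℕ} {U V : Set (Fin n → ℂ)} (hU : IsOpen U) (hV : IsOpen V)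
    {g h : (Fin n → ℂ) → ℂ} (hg : DifferentiableOn ℂ g U)
    (hgU : U ⊆ closure {y ∈ U | g y ≠ 0}) (hhV : V ⊆ closure {y ∈ V | h y ≠ 0}) :
    U ∩ V ⊆ closure {y ∈ U ∩ V | g y * h y ≠ 0} := by
  rintro z ⟨hzU, hzV⟩
  rw [mem_closure_iff]
  intro W hW hzW
  obtain ⟨y, ⟨hyW, hyV⟩, hyU, hy⟩ :=
    mem_closure_iff.1 (hgU hzU) (W ∩ V) (hW.inter hV) ⟨hzW, hzV⟩
  have hO : IsOpen (U ∩ g ⁻¹' {0}ᶜ) :=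
    hg.continuousOn.isOpen_inter_preimage hU isClosed_singleton.isOpen_compl
  obtain ⟨x, ⟨hxW, hxU, hx⟩, hxV, hx'⟩ :=
    mem_closure_iff.1 (hhV hyV) (W ∩ (U ∩ g ⁻¹' {0}ᶜ)) (hW.inter hO) ⟨hyW, hyU, hy⟩
  exact ⟨x, hxW, ⟨hxU, hxV⟩, mul_ne_zero hx hx'⟩

theorem IsMero.mul {n : ℕ} {f₁ f₂ : (Fin n → ℂ) → ℂ} (h₁ : IsMero f₁) (h₂ : IsMero f₂) :
    IsMero (f₁ * f₂) := by
  intro z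
  obtain ⟨U, hU, hzU, g, h, hg, hh, hd, e⟩ := h₁ z
  obtain ⟨V, hV, hzV, g', h', hg', hh', hd', e'⟩ := h₂ z
  refine ⟨U ∩ V, hU.inter hV, ⟨hzU, hzV⟩, fun y => g y * g' y, fun y => h y * h' y,
    (hg.mono Set.inter_subset_left).mul (hg'.mono Set.inter_subset_right),
    (hh.mono Set.inter_subset_left).mul (hh'.mono Set.inter_subset_right),
    subset_closure_mul hU hV hh hd hd', ?_⟩
  rintro y ⟨hyU, hyV⟩ hy
  have := mul_ne_zero_iff.1 hy
  rw [Pi.mul_apply, e y hyU this.1, e' y hyV this.2, div_mul_div_comm]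

theorem IsMero.add {n : ℕ} {f₁ f₂ : (Fin n → ℂ) → ℂ} (h₁ : IsMero f₁) (h₂ : IsMero f₂) :
    IsMero (f₁ + f₂) := by
  intro z
  obtain ⟨U, hU, hzU, g, h, hg, hh, hd, e⟩ := h₁ z
  obtain ⟨V, hV, hzV, g', h', hg', hh', hd', e'⟩ := h₂ z
  refine ⟨U ∩ V, hU.inter hV, ⟨hzU, hzV⟩, fun y => g y * h' y + h y * g' y,
    fun y => h y * h' y,
    ((hg.mono Set.inter_subset_left).mul (hh'.mono Set.inter_subset_right)).add
      ((hh.mono Set.inter_subset_left).mul (hg'.mono Set.inter_subset_right)),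
    (hh.mono Set.inter_subset_left).mul (hh'.mono Set.inter_subset_right),
    subset_closure_mul hU hV hh hd hd', ?_⟩
  rintro y ⟨hyU, hyV⟩ hy
  have := mul_ne_zero_iff.1 hy
  rw [Pi.add_apply, e y hyU this.1, e' y hyV this.2, div_add_div _ _ this.1 this.2]

/-- The algebra of functions on `ℂⁿ` representing meromorphic functions. -/
def meroFun (n : ℕ) : Subalgebra ℂ ((Fin n → ℂ) → ℂ) where
  carrier := {f | IsMero f}
  mul_mem' := IsMero.mul
  add_mem' := IsMero.add
  algebraMap_mem' c := IsMero.of_differentiable (differentiable_const c)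

/-- Representatives of the zero function: those vanishing on a dense open set. -/
def meroNull (n : ℕ) : Ideal (meroFun n) where
  carrier := {f | ∃ D : Set (Fin n → ℂ), IsOpen D ∧ Dense D ∧ ∀ y ∈ D, f.1 y = 0}
  zero_mem' := ⟨Set.univ, isOpen_univ, dense_univ, fun _ _ => rfl⟩
  add_mem' := by
    rintro f g ⟨D, hD, hD', h⟩ ⟨D₂, hD₂, hD₂', h₂⟩
    refine ⟨D ∩ D₂, hD.inter hD₂, hD'.inter_of_isOpen_left hD₂' hD, fun y hy => ?_⟩
    change f.1 y + g.1 y = 0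
    rw [h y hy.1, h₂ y hy.2, add_zero]
  smul_mem' := by
    rintro c f ⟨D, hD, hD', h⟩
    refine ⟨D, hD, hD', fun y hy => ?_⟩
    change c.1 y * f.1 y = 0
    rw [h y hy, mul_zero]

/-- The algebra `𝓜` of meromorphic functions on `ℂⁿ`. -/
abbrev Mero (n : ℕ) : Type := meroFun n ⧸ meroNull n

theorem isOpenMap_comp_perm {n : ℕ} (σ : Equiv.Perm (Fin n)) :
    IsOpenMap (fun ξ : Fin n → ℂ => ξ ∘ σ) := by
  have hc : Continuous (fun ξ : Fin n → ℂ => ξ ∘ σ.symm) :=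
    continuous_pi fun i => continuous_apply (σ.symm i)
  exact IsOpenMap.of_inverse hc (fun ξ => by ext i; simp) (fun ξ => by ext i; simp)

theorem IsMero.comp_perm {n : ℕ} (σ : Equiv.Perm (Fin n)) {f : (Fin n → ℂ) → ℂ}
    (hf : IsMero f) : IsMero (fun ξ => f (ξ ∘ σ)) := by
  intro z
  obtain ⟨U, hU, hzU, g, h, hg, hh, hd, e⟩ := hf (z ∘ σ)
  have hs : Differentiable ℂ (fun ξ : Fin n → ℂ => ξ ∘ σ) :=
    differentiable_pi.2 fun i => differentiable_apply (σ i)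
  have ho := isOpenMap_comp_perm σ
  refine ⟨(fun ξ => ξ ∘ σ) ⁻¹' U, hU.preimage hs.continuous, hzU, fun ξ => g (ξ ∘ σ),
    fun ξ => h (ξ ∘ σ), hg.comp hs.differentiableOn fun _ hx => hx,
    hh.comp hs.differentiableOn fun _ hx => hx, ?_, fun y hy hy' => e _ hy hy'⟩
  intro y hy
  exact ho.preimage_closure_subset_closure_preimage (hd hy)

/-- `f ↦ f(s ξ)` for a permutation `s` of the coordinates, on representatives. -/
def meroFunPerm {n : ℕ} (σ : Equiv.Perm (Fin n)) : meroFun n →ₐ[ℂ] meroFun n where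
  toFun f := ⟨fun ξ => f.1 (ξ ∘ σ), IsMero.comp_perm σ f.2⟩
  map_one' := rfl
  map_mul' _ _ := rfl
  map_zero' := rfl
  map_add' _ _ := rfl
  commutes' _ := rfl

/-- The action `f ↦ f(s ξ)` of coordinate permutations on meromorphic functions. -/
def meroPerm {n : ℕ} (σ : Equiv.Perm (Fin n)) : Mero n →ₐ[ℂ] Mero n :=
  Ideal.quotientMapₐ (meroNull n) (meroFunPerm σ) (by
    rintro f ⟨D, hD, hD', h⟩
    have hs : Continuous (fun ξ : Fin n → ℂ => ξ ∘ σ) :=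
      continuous_pi fun i => continuous_apply (σ i)
    exact ⟨(fun ξ => ξ ∘ σ) ⁻¹' D, hD.preimage hs, hD'.preimage (isOpenMap_comp_perm σ),
      fun y hy => h _ hy⟩)

theorem isOpenMap_coord_sub {n : ℕ} {i j : Fin n} (hij : i ≠ j) :
    IsOpenMap (fun ξ : Fin n → ℂ => ξ i - ξ j) := by
  let L : (Fin n → ℂ) →L[ℂ] ℂ :=
    ContinuousLinearMap.proj (R := ℂ) (φ := fun _ : Fin n => ℂ) i -
      ContinuousLinearMap.proj (R := ℂ) (φ := fun _ : Fin n => ℂ) j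
  have hL : Function.Surjective L := fun w => ⟨Pi.single i w, by simp [L, hij.symm]⟩
  exact L.isOpenMap hL

theorem Mero₁.isMero {n : ℕ} (f : Mero₁) (i j : Fin n) :
    IsMero (fun ξ : Fin n → ℂ => f.1 (ξ i - ξ j)) := by
  by_cases hij : i = j
  · subst hij
    simpa using IsMero.of_differentiable (differentiable_const (f.1 0))
  intro z
  set π : (Fin n → ℂ) → ℂ := fun ξ => ξ i - ξ j with hπ
  have hπd : Differentiable ℂ π := (differentiable_apply i).sub (differentiable_apply j)
  obtain ⟨N, hN⟩ := f.2 (π z)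
  obtain ⟨V, hV, hzV⟩ := hN.eventually_analyticAt.exists_mem |> fun ⟨V, hV, h⟩ =>
    (⟨interior V, ⟨isOpen_interior, mem_interior_iff_mem_nhds.2 hV⟩,
      fun w hw => h w (interior_subset hw)⟩ :
      ∃ V : Set ℂ, (IsOpen V ∧ π z ∈ V) ∧
        ∀ w ∈ V, AnalyticAt ℂ (fun x => (x - π z) ^ N • f.1 x) w)
  have hd : Dense {y : Fin n → ℂ | (π y - π z) ^ N ≠ 0} := by
    refine ((dense_compl_singleton (π z)).preimage (isOpenMap_coord_sub hij)).mono ?_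
    intro y hy
    exact pow_ne_zero _ (sub_ne_zero.2 hy)
  refine ⟨π ⁻¹' V, hV.1.preimage hπd.continuous, hV.2,
    fun y => (π y - π z) ^ N • f.1 (π y), fun y => (π y - π z) ^ N, ?_, ?_, ?_, ?_⟩
  · have h1 : DifferentiableOn ℂ (fun x => (x - π z) ^ N • f.1 x) V :=
      fun w hw => (hzV w hw).differentiableAt.differentiableWithinAt
    exact h1.comp hπd.differentiableOn fun _ hy => hy
  · exact ((hπd.sub_const _).pow N).differentiableOn
  · exact hd.open_subset_closure_inter (hV.1.preimage hπd.continuous)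
  · intro y _ hy
    change f.1 (π y) = (π y - π z) ^ N * f.1 (π y) / (π y - π z) ^ N
    rw [mul_div_cancel_left₀ _ hy]

/-- The meromorphic function `f(xᵢ - xⱼ)` on `ℂⁿ`. -/
def Mero₁.diff {n : ℕ} (f : Mero₁) (i j : Fin n) : Mero n :=
  Ideal.Quotient.mk (meroNull n) ⟨fun ξ => f.1 (ξ i - ξ j), f.isMero i j⟩

/-! ### The algebra `Ẽₙ(φᵢⱼ, ψᵢⱼ)` -/

/-- Generators: the symbols `⟨ij⟩` and the meromorphic functions on `ℂⁿ`. -/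
abbrev EllGen (n : ℕ) : Type := (Fin n × Fin n) ⊕ Mero n

/-- The free algebra generator for the symbol `⟨ij⟩`. -/
def genBr {n : ℕ} (i j : Fin n) : FreeAlgebra ℂ (EllGen n) := FreeAlgebra.ι ℂ (Sum.inl (i, j))

/-- The free algebra generator for a meromorphic function. -/
def genFun {n : ℕ} (f : Mero n) : FreeAlgebra ℂ (EllGen n) := FreeAlgebra.ι ℂ (Sum.inr f)

/-- Defining relations of `Ẽₙ(φᵢⱼ, ψᵢⱼ)`. The first three make `𝓜` a subalgebra of coefficients;
`diag` discards the unused symbols `⟨ii⟩`; `⟨ji⟩ = -⟨ij⟩` as for the brackets of roots. -/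
inductive EllRel {n : ℕ} (φ ψ : Fin n → Fin n → Mero₁) :
    FreeAlgebra ℂ (EllGen n) → FreeAlgebra ℂ (EllGen n) → Prop
  | fun_add (f g : Mero n) : EllRel φ ψ (genFun (f + g)) (genFun f + genFun g)
  | fun_mul (f g : Mero n) : EllRel φ ψ (genFun (f * g)) (genFun f * genFun g)
  | fun_const (c : ℂ) : EllRel φ ψ (genFun (algebraMap ℂ (Mero n) c)) (algebraMap ℂ _ c)
  | diag (i : Fin n) : EllRel φ ψ (genBr i i) 0
  | antisymm (i j : Fin n) : EllRel φ ψ (genBr j i) (-genBr i j)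
  | sq (i j : Fin n) (hij : i ≠ j) :
      EllRel φ ψ (genBr i j ^ 2) (genFun ((ψ i j).diff i j))
  | comm (i j k l : Fin n) (hij : i ≠ j) (hkl : k ≠ l)
      (hik : i ≠ k) (hil : i ≠ l) (hjk : j ≠ k) (hjl : j ≠ l) :
      EllRel φ ψ (genBr i j * genBr k l) (genBr k l * genBr i j)
  | threeTerm (i j k : Fin n) (hij : i ≠ j) (hjk : j ≠ k) (hki : k ≠ i) :
      EllRel φ ψ (genBr i j * genBr j k + genBr j k * genBr k i + genBr k i * genBr i j) 0
  | twist (i j : Fin n) (hij : i ≠ j) (f : Mero n) :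
      EllRel φ ψ ((genBr i j - genFun ((φ i j).diff i j)) * genFun f)
        (genFun (meroPerm (Equiv.swap i j) f) * (genBr i j - genFun ((φ i j).diff i j)))

/-- The algebra `Ẽₙ(φᵢⱼ, ψᵢⱼ)`. -/
abbrev EllAlg {n : ℕ} (φ ψ : Fin n → Fin n → Mero₁) : Type := RingQuot (EllRel φ ψ)

/-- The element `[ij] = ⟨ij⟩ - φᵢⱼ(xᵢ - xⱼ)` of `Ẽₙ(φᵢⱼ, ψᵢⱼ)`. -/
def EllAlg.br {n : ℕ} (φ ψ : Fin n → Fin n → Mero₁) (i j : Fin n) : EllAlg φ ψ :=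
  RingQuot.mkAlgHom ℂ (EllRel φ ψ) (genBr i j - genFun ((φ i j).diff i j))

/-! ### The rational family and its limit -/

theorem meromorphicAt_div_pow (c : ℂ) (m : ℕ) (z : ℂ) :
    MeromorphicAt (fun z : ℂ => c / z ^ m) z :=
  (MeromorphicAt.const c z).div ((MeromorphicAt.id z).pow m)

/-- The function `a / z`, which is every `φᵢⱼ`. -/
def simplePole (a : ℂ) : Mero₁ :=
  ⟨fun z => a / z, fun z => (MeromorphicAt.const a z).div (MeromorphicAt.id z)⟩

/-- The rational solution `ψᵢⱼ(z) = (A - K) / z² + K / (λᵢ - λⱼ)²`. -/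
def rationalPsi {n : ℕ} (A K : ℂ) (lam : Fin n → ℂ) (i j : Fin n) : Mero₁ :=
  ⟨fun z => (A - K) / z ^ 2 + K / (lam i - lam j) ^ 2, fun z =>
    (meromorphicAt_div_pow _ 2 z).add (MeromorphicAt.const _ z)⟩

/-- The algebra `Ẽₙ(ψᵢⱼ)`, that is `Ẽₙ(φᵢⱼ, ψᵢⱼ)` with `φᵢⱼ(z) = a / z`. -/
abbrev TildeE {n : ℕ} (a : ℂ) (ψ : Fin n → Fin n → Mero₁) : Type :=
  EllAlg (fun _ _ => simplePole a) ψ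

/-- The element `[ij] = ⟨ij⟩ - a / (xᵢ - xⱼ)` of `Ẽₙ(ψᵢⱼ)`. -/
abbrev TildeE.br {n : ℕ} (a : ℂ) (ψ : Fin n → Fin n → Mero₁) (i j : Fin n) : TildeE a ψ :=
  EllAlg.br (fun _ _ => simplePole a) ψ i j

/-- The parameters `pᵢⱼ = κ / (Λᵢ - Λⱼ)²`. -/
def limParam {n : ℕ} (κ : ℂ) (Λ : Fin n → ℂ) (i j : Fin n) : ℂ := κ / (Λ i - Λ j) ^ 2

/-- The function `A / z² + pᵢⱼ`. -/
def constPsi {n : ℕ} (A : ℂ) (p : Fin n → Fin n → ℂ) (i j : Fin n) : Mero₁ :=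
  ⟨fun z => A / z ^ 2 + p i j, fun z =>
    (meromorphicAt_div_pow _ 2 z).add (MeromorphicAt.const _ z)⟩

/-! ### The multiparameter deformation `𝓔ₙᵖ` -/

/-- Defining relations of `𝓔ₙᵖ` over a commutative ring containing the parameters `pᵢⱼ`;
`diag` discards the unused symbols `[ii]`. -/
inductive FKRel {n : ℕ} {R : Type*} [CommRing R] (p : Fin n → Fin n → R) :
    FreeAlgebra R (Fin n × Fin n) → FreeAlgebra R (Fin n × Fin n) → Prop
  | diag (i : Fin n) : FKRel p (FreeAlgebra.ι R (i, i)) 0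
  | antisymm (i j : Fin n) : FKRel p (FreeAlgebra.ι R (j, i)) (-FreeAlgebra.ι R (i, j))
  | sq (i j : Fin n) (hij : i ≠ j) :
      FKRel p (FreeAlgebra.ι R (i, j) ^ 2) (algebraMap R _ (p i j))
  | comm (i j k l : Fin n) (hij : i ≠ j) (hkl : k ≠ l)
      (hik : i ≠ k) (hil : i ≠ l) (hjk : j ≠ k) (hjl : j ≠ l) :
      FKRel p (FreeAlgebra.ι R (i, j) * FreeAlgebra.ι R (k, l))
        (FreeAlgebra.ι R (k, l) * FreeAlgebra.ι R (i, j))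
  | threeTerm (i j k : Fin n) (hij : i ≠ j) (hjk : j ≠ k) (hki : k ≠ i) :
      FKRel p (FreeAlgebra.ι R (i, j) * FreeAlgebra.ι R (j, k) +
        FreeAlgebra.ι R (j, k) * FreeAlgebra.ι R (k, i) +
        FreeAlgebra.ι R (k, i) * FreeAlgebra.ι R (i, j)) 0

/-- The multiparameter deformation `𝓔ₙᵖ` of the Fomin–Kirillov algebra. -/
abbrev FKAlg {n : ℕ} {R : Type*} [CommRing R] (p : Fin n → Fin n → R) : Type _ :=
  RingQuot (FKRel p)

/-- The generator `[ij]` of `𝓔ₙᵖ`. -/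
def FKAlg.br {n : ℕ} {R : Type*} [CommRing R] (p : Fin n → Fin n → R) (i j : Fin n) :
    FKAlg p :=
  RingQuot.mkAlgHom R (FKRel p) (FreeAlgebra.ι R (i, j))

/-! ### Dunkl elements, deformed elementary symmetric polynomials, the right-hand side -/

/-- The Dunkl element `θᵢ = ∑_{j ≠ i} [ij]` of a family of brackets. -/
def dunkl {n : ℕ} {A : Type*} [Ring A] (br : Fin n → Fin n → A) (i : Fin n) : A :=
  ∑ j ∈ Finset.univ.erase i, br i j

/-- The `p`-deformed elementary symmetric polynomial `E_k(X_i, i ∈ I; p)`, for elements `X_i` of an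
`R`-algebra: `E_0(I) = 1` and
`E_k(I ∪ {j}) = E_k(I) + E_{k-1}(I) X_j + ∑_{i ∈ I} p_{ij} E_{k-2}(I \ {i})` (with `E_{-1} = 0`),
`j` being the largest element of `I ∪ {j}`. For commuting `X_i` and symmetric `p` the recursion
holds for every `j ∉ I`, see `pElem_insert`. -/
def pElem {n : ℕ} {R A : Type*} [CommRing R] [Ring A] [Algebra R A] (p : Fin n → Fin n → R)
    (X : Fin n → A) : ℕ → Finset (Fin n) → A
  | 0, _ => 1
  | k + 1, I =>
    if h : I.Nonempty then
      pElem p X (k + 1) (I.erase (I.max' h)) + pElem p X k (I.erase (I.max' h)) * X (I.max' h) +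
        (if k = 0 then 0 else
          ∑ i ∈ I.erase (I.max' h),
            p i (I.max' h) • pElem p X (k - 1) ((I.erase (I.max' h)).erase i))
    else 0
termination_by _ I => I.card
decreasing_by
  all_goals
    first
      | exact Finset.card_erase_lt_of_mem (I.max'_mem h)
      | exact lt_of_le_of_lt (Finset.card_erase_le)
          (Finset.card_erase_lt_of_mem (I.max'_mem h))

section pElem

variable {n : ℕ} {R A : Type*} [CommRing R] [Ring A] [Algebra R A]
  (p : Fin n → Fin n → R) (X : Fin n → A)

theorem pElem_zero (I : Finset (Fin n)) : pElem p X 0 I = 1 := by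
  rw [pElem]

theorem pElem_empty (k : ℕ) : pElem p X (k + 1) ∅ = 0 := by
  rw [pElem]; simp

/-- `pElem` indexed by `ℤ`, zero for negative index. -/
def pElemZ (k : ℤ) (I : Finset (Fin n)) : A := if k < 0 then 0 else pElem p X k.toNat I

theorem pElemZ_neg {k : ℤ} (hk : k < 0) (I : Finset (Fin n)) : pElemZ p X k I = 0 := if_pos hk

theorem pElemZ_natCast (k : ℕ) (I : Finset (Fin n)) : pElemZ p X k I = pElem p X k I := by
  simp [pElemZ]

theorem pElemZ_insert_max (I : Finset (Fin n)) (m : Fin n) (hm : ∀ i ∈ I, i < m) (k : ℤ) :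
    pElemZ p X k (insert m I) = pElemZ p X k I + pElemZ p X (k - 1) I * X m +
      ∑ i ∈ I, p i m • pElemZ p X (k - 2) (I.erase i) := by
  have hmI : m ∉ I := fun h => lt_irrefl _ (hm m h)
  rcases lt_or_ge k 0 with hk | hk
  · simp [pElemZ_neg p X hk, pElemZ_neg p X (show k - 1 < 0 by omega),
      pElemZ_neg p X (show k - 2 < 0 by omega)]
  obtain ⟨k, rfl⟩ := Int.eq_ofNat_of_zero_le hk
  have hmax : (insert m I).max' (Finset.insert_nonempty m I) = m := by
    apply le_antisymm
    · refine Finset.max'_le _ _ _ fun i hi => ?_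
      rcases Finset.mem_insert.1 hi with rfl | hi
      · exact le_rfl
      · exact (hm i hi).le
    · exact Finset.le_max' _ _ (Finset.mem_insert_self m I)
  rcases k with _ | k
  · rw [pElemZ_natCast, pElemZ_natCast, pElem_zero, pElem_zero]
    simp [pElemZ_neg p X (show (-1 : ℤ) < 0 by omega),
      pElemZ_neg p X (show (-2 : ℤ) < 0 by omega)]
  · rw [pElemZ_natCast, pElemZ_natCast, show ((k + 1 : ℕ) : ℤ) - 1 = (k : ℕ) by push_cast; ring,
      pElemZ_natCast]
    conv_lhs => rw [pElem]
    rw [dif_pos (Finset.insert_nonempty m I)]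
    simp only [hmax, Finset.erase_insert hmI]
    congr 1
    rcases k with _ | k
    · simp [pElemZ_neg p X (show (-1 : ℤ) < 0 by omega)]
    · rw [if_neg (Nat.succ_ne_zero k),
        show ((k + 1 + 1 : ℕ) : ℤ) - 2 = (k : ℕ) by push_cast; ring]
      simp only [pElemZ_natCast, Nat.add_sub_cancel]

theorem pElemZ_commute (hX : ∀ i j, Commute (X i) (X j)) (j : Fin n) (I : Finset (Fin n)) :
    ∀ k : ℤ, Commute (pElemZ p X k I) (X j) := by
  induction hc : I.card using Nat.strong_induction_on generalizing I with
  | _ c ih =>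
  subst hc
  intro k
  rcases I.eq_empty_or_nonempty with rfl | hI
  · rcases lt_or_ge k 0 with hk | hk
    · rw [pElemZ_neg p X hk]; exact Commute.zero_left _
    obtain ⟨k, rfl⟩ := Int.eq_ofNat_of_zero_le hk
    rw [pElemZ_natCast]
    rcases k with _ | k
    · rw [pElem_zero]; exact Commute.one_left _
    · rw [pElem_empty]; exact Commute.zero_left _
  · have hm := I.max'_mem hI
    have hlt := Finset.card_erase_lt_of_mem hm
    rw [← Finset.insert_erase hm, pElemZ_insert_max p X _ _ (fun i hi =>
      lt_of_le_of_ne (I.le_max' i (Finset.mem_of_mem_erase hi)) (Finset.ne_of_mem_erase hi))]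
    refine ((ih _ hlt _ rfl k).add_left ((ih _ hlt _ rfl _).mul_left (hX _ _))).add_left ?_
    refine Commute.sum_left _ _ _ fun i _ => Commute.smul_left ?_ _
    exact ih _ (lt_of_le_of_lt Finset.card_erase_le hlt) _ rfl _

theorem pElemZ_insert (hp : ∀ i j, p i j = p j i) (hX : ∀ i j, Commute (X i) (X j))
    (I : Finset (Fin n)) : ∀ (j : Fin n), j ∉ I → ∀ k : ℤ,
    pElemZ p X k (insert j I) = pElemZ p X k I + pElemZ p X (k - 1) I * X j +
      ∑ i ∈ I, p i j • pElemZ p X (k - 2) (I.erase i) := by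
  induction hc : I.card using Nat.strong_induction_on generalizing I with
  | _ c ih =>
  subst hc
  intro j hj k
  by_cases hjm : ∀ i ∈ I, i < j
  · exact pElemZ_insert_max p X I j hjm k
  push Not at hjm
  obtain ⟨i₀, hi₀, hji₀⟩ := hjm
  obtain ⟨m, hm, hmax⟩ : ∃ m ∈ I, ∀ i ∈ I, i ≤ m :=
    ⟨_, I.max'_mem ⟨i₀, hi₀⟩, fun i hi => I.le_max' i hi⟩
  obtain ⟨I', hmI', rfl⟩ : ∃ I', m ∉ I' ∧ I = insert m I' :=
    ⟨I.erase m, Finset.notMem_erase m I, (Finset.insert_erase hm).symm⟩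
  have hjne : j ≠ m := fun h => hj (h ▸ Finset.mem_insert_self _ _)
  have hjI' : j ∉ I' := fun h => hj (Finset.mem_insert_of_mem h)
  have hlt : ∀ i ∈ I', i < m := fun i hi => lt_of_le_of_ne
    (hmax i (Finset.mem_insert_of_mem hi)) (fun h => hmI' (h ▸ hi))
  have hjm : j < m := lt_of_le_of_ne (hji₀.trans (hmax _ hi₀)) hjne
  have hcard : I'.card < (insert m I').card := by
    rw [Finset.card_insert_of_notMem hmI']; exact Nat.lt_succ_self _
  have hS : ∀ i ∈ I', pElemZ p X (k - 2) ((insert j I').erase i) =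
      pElemZ p X (k - 2) (I'.erase i) + pElemZ p X (k - 2 - 1) (I'.erase i) * X j +
        ∑ l ∈ I'.erase i, p l j • pElemZ p X (k - 2 - 2) ((I'.erase i).erase l) := by
    intro i hi
    rw [Finset.erase_insert_of_ne (fun h : j = i => hjI' (h ▸ hi))]
    exact ih _ (lt_of_le_of_lt Finset.card_erase_le hcard) _ rfl j
      (fun h => hjI' (Finset.mem_of_mem_erase h)) _
  have hT : ∀ i ∈ I', pElemZ p X (k - 2) ((insert m I').erase i) =
      pElemZ p X (k - 2) (I'.erase i) + pElemZ p X (k - 2 - 1) (I'.erase i) * X m +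
        ∑ l ∈ I'.erase i, p l m • pElemZ p X (k - 2 - 2) ((I'.erase i).erase l) := by
    intro i hi
    rw [Finset.erase_insert_of_ne (fun h : m = i => hmI' (h ▸ hi))]
    exact pElemZ_insert_max p X _ m (fun l hl => hlt l (Finset.mem_of_mem_erase hl)) _
  have hswap : ∑ i ∈ I', p i m • ∑ l ∈ I'.erase i,
        p l j • pElemZ p X (k - 2 - 2) ((I'.erase i).erase l) =
      ∑ i ∈ I', p i j • ∑ l ∈ I'.erase i,
        p l m • pElemZ p X (k - 2 - 2) ((I'.erase i).erase l) := by
    simp only [Finset.smul_sum]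
    rw [Finset.sum_comm' (t' := I') (s' := fun l => I'.erase l)
      (by intro x y; simp only [Finset.mem_erase]; tauto)]
    refine Finset.sum_congr rfl fun i _ => Finset.sum_congr rfl fun l _ => ?_
    rw [smul_comm, Finset.erase_right_comm]
  rw [Finset.insert_comm, pElemZ_insert_max p X (insert j I') m
      (fun i hi => (Finset.mem_insert.1 hi).elim (fun h => h ▸ hjm) (hlt i)),
    ih _ hcard I' rfl j hjI' k, ih _ hcard I' rfl j hjI' (k - 1),
    pElemZ_insert_max p X I' m hlt k, pElemZ_insert_max p X I' m hlt (k - 1),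
    Finset.sum_insert hjI', Finset.sum_insert hmI', Finset.erase_insert hjI',
    Finset.erase_insert hmI']
  rw [Finset.sum_congr (f := fun i => p i m • pElemZ p X (k - 2) ((insert j I').erase i)) rfl
      fun i hi => congrArg (p i m • ·) (hS i hi),
    Finset.sum_congr (f := fun i => p i j • pElemZ p X (k - 2) ((insert m I').erase i)) rfl
      fun i hi => congrArg (p i j • ·) (hT i hi)]
  simp only [smul_add, Finset.sum_add_distrib, add_mul, Finset.sum_mul, smul_mul_assoc]
  rw [hswap, hp j m, mul_assoc (pElemZ p X (k - 1 - 1) I') (X j), (hX j m).eq,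
    ← mul_assoc, show k - 1 - 2 = k - 2 - 1 by ring]
  abel

/-- The recursion defining the deformed elementary symmetric polynomials, in every order. -/
theorem pElem_insert (hp : ∀ i j, p i j = p j i) (hX : ∀ i j, Commute (X i) (X j))
    (I : Finset (Fin n)) (j : Fin n) (hj : j ∉ I) (k : ℕ) :
    pElem p X 1 (insert j I) = pElem p X 1 I + pElem p X 0 I * X j ∧
    pElem p X (k + 2) (insert j I) = pElem p X (k + 2) I + pElem p X (k + 1) I * X j +
      ∑ i ∈ I, p i j • pElem p X k (I.erase i) := by
  constructor
  · have h := pElemZ_insert p X hp hX I j hj ((1 : ℕ) : ℤ)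
    rw [show (((1 : ℕ) : ℤ) - 1) = ((0 : ℕ) : ℤ) by norm_num] at h
    simp only [pElemZ_natCast] at h
    rw [h, add_eq_left]
    refine Finset.sum_eq_zero fun i _ => ?_
    rw [pElemZ_neg p X (by norm_num), smul_zero]
  · have h := pElemZ_insert p X hp hX I j hj ((k + 2 : ℕ) : ℤ)
    rw [show (((k + 2 : ℕ) : ℤ) - 1) = ((k + 1 : ℕ) : ℤ) by push_cast; ring,
      show (((k + 2 : ℕ) : ℤ) - 2) = (k : ℤ) by push_cast; ring] at h
    simpa only [pElemZ_natCast] using h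

/-- Algebra homomorphisms commute with `pElem`: it is the value of one polynomial. -/
theorem map_pElem {B : Type*} [Ring B] [Algebra R B] (f : A →ₐ[R] B) (k : ℕ)
    (I : Finset (Fin n)) : f (pElem p X k I) = pElem p (fun i => f (X i)) k I := by
  induction hc : I.card using Nat.strong_induction_on generalizing I k with
  | _ c ih =>
  subst hc
  rcases k with _ | k
  · rw [pElem_zero, pElem_zero, map_one]
  rcases I.eq_empty_or_nonempty with rfl | hI
  · rw [pElem_empty, pElem_empty, map_zero]
  have hlt := Finset.card_erase_lt_of_mem (I.max'_mem hI)
  rw [pElem, dif_pos hI]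
  conv_rhs => rw [pElem]
  rw [dif_pos hI, map_add, map_add, map_mul, ih _ hlt _ _ rfl, ih _ hlt _ _ rfl]
  congr 1
  split_ifs
  · exact map_zero f
  · rw [map_sum]
    refine Finset.sum_congr rfl fun i _ => ?_
    rw [map_smul, ih _ (lt_of_le_of_lt Finset.card_erase_le hlt) _ _ rfl]

end pElem

open Classical in
/-- `∑ [a₁ b₁] ⋯ [a_k b_k]` over distinct `a₁, …, a_k ∈ I` and `b₁ ≤ ⋯ ≤ b_k` outside `I`. -/
def pieriSum {n : ℕ} {A : Type*} [Ring A] (br : Fin n → Fin n → A) (k : ℕ)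
    (I : Finset (Fin n)) : A :=
  ∑ ab : (Fin k → Fin n) × (Fin k → Fin n) with
      (∀ s, ab.1 s ∈ I) ∧ (∀ s, ab.2 s ∉ I) ∧ Function.Injective ab.1 ∧ Monotone ab.2,
    (List.ofFn fun s => br (ab.1 s) (ab.2 s)).prod

end DeformedFK

end

open DeformedFK

/-! Everything is proved for an arbitrary family of brackets `[ij]` satisfying the relations of
`𝓔ₙᵖ` (`IsFKFamily`), and then applied both to `𝓔ₙᵖ` and to the limit algebra. Commutation of the
Dunkl elements is a direct consequence of the three-term relations.

For the formula, adjoin central variables `tₐ` with `tₐ² = 0` and put `W_I(b) = (1 - ∑_{a ∈ I}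
tₐ[ab])⁻¹`. Expanding the geometric series gives the words `[a₁b]⋯[a_kb]` weighted by
`t_{a₁}⋯t_{a_k}`, and square-zero variables force the `aₛ` to be distinct. Multiplying `W_I(b)` over
`b ∉ I` in increasing order and summing the coefficients of all squarefree monomials of degree `k`
therefore yields the right-hand side (`sum_coeff_genProd`).

It remains to see that these degree `k` parts obey the recursion of the deformed elementary
polynomials (`prodW_insert_eq`, `grade_genProd_insert`). Adding `j` to `I` inserts one bracket
`[jl]` into the product. Moving it to the right end with the three-term relation (`mul_W`) assembles
`θ_j = ∑_{l ∉ I} [jl] - ∑_{i ∈ I} [ij]`, up to terms `[ij] W_I(j) [ij]`. The cyclic relation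
(`sum_mul_W_mul`) turns these into `∑ tᵢ pᵢⱼ W_{I∖i}(i)`, which is the `E_{k-2}` term. That relation
holds because the coefficients of each `tₑ` on its two sides (`cyc`, `cycParam`) satisfy one and the
same recursion with invertible leading factor.

In the limit algebra, substituting `⟨ij⟩ = [ij] + a/(xᵢ - xⱼ)` makes all pole terms cancel, through
the twist relation and the three-term identity for `1/(xᵢ - xⱼ)`; so the brackets satisfy the
relations of `𝓔ₙᵖ`. No further relations arise, because the limit algebra acts on `𝓜 ⊗ 𝓔ₙᵖ` with
`[ij]` acting as `s_{ij} ⊗ [ij]`, and this action recovers left multiplication of `𝓔ₙᵖ` on itself.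
-/

/-- A family of brackets satisfying the defining relations of `𝓔ₙᵖ`. -/
structure IsFKFamily {ι R A : Type*} [CommRing R] [Ring A] [Algebra R A]
    (p : ι → ι → R) (br : ι → ι → A) : Prop where
  diag : ∀ i, br i i = 0
  antisymm : ∀ i j, br j i = -br i j
  sq : ∀ i j, i ≠ j → br i j * br i j = algebraMap R A (p i j)
  comm : ∀ i j k l, i ≠ j → k ≠ l → i ≠ k → i ≠ l → j ≠ k → j ≠ l →
    Commute (br i j) (br k l)
  threeTerm : ∀ i j k, i ≠ j → j ≠ k → k ≠ i →
    br i j * br j k + br j k * br k i + br k i * br i j = 0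

/-! ### Bracket families and the commutation of Dunkl elements -/

namespace IsFKFamily

section general

variable {ι R A : Type*} [CommRing R] [Ring A] [Algebra R A] {p : ι → ι → R} {br : ι → ι → A}

theorem map {B : Type*} [Ring B] [Algebra R B] (h : IsFKFamily p br) (f : A →ₐ[R] B) :
    IsFKFamily p (fun i j => f (br i j)) where
  diag i := by rw [h.diag, map_zero]
  antisymm i j := by rw [h.antisymm i j, map_neg]
  sq i j hij := by rw [← map_mul, h.sq i j hij, AlgHom.commutes]
  comm i j k l h1 h2 h3 h4 h5 h6 := (h.comm i j k l h1 h2 h3 h4 h5 h6).map f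
  threeTerm i j k h1 h2 h3 := by
    simp only [← map_mul, ← map_add]
    rw [h.threeTerm i j k h1 h2 h3, map_zero]

/-- The three-term relation rewritten as an exchange rule for two brackets with the same second
index; this is the form in which it is used for Dunkl elements and generating series. -/
theorem mul_eq (h : IsFKFamily p br) {i j k : ι} (hij : i ≠ j) (hik : i ≠ k) (hjk : j ≠ k) :
    br i k * br j k = br j k * br i j - br i j * br i k := by
  have := h.threeTerm i k j hik hjk.symm hij.symm
  rw [h.antisymm j k, h.antisymm i j] at this
  simp only [mul_neg, neg_mul, neg_neg] at this
  rw [← sub_eq_zero, ← neg_eq_zero, ← this]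
  abel

/-- After separating `[ij]` from both sums, the commutator splits into contributions of single third
indices `k`, each vanishing by the three-term relation for `i, j, k`. -/
theorem dunkl_commute [Fintype ι] [DecidableEq ι] (h : IsFKFamily p br) (i j : ι) :
    Commute (∑ k ∈ Finset.univ.erase i, br i k) (∑ k ∈ Finset.univ.erase j, br j k) := by
  rcases eq_or_ne i j with rfl | hij
  · exact Commute.refl _
  set K : Finset ι := (Finset.univ.erase i).erase j with hK
  have hi : ∑ k ∈ Finset.univ.erase i, br i k = br i j + ∑ k ∈ K, br i k :=
    (Finset.add_sum_erase _ _ (by simp [hij.symm])).symm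
  have hj : ∑ k ∈ Finset.univ.erase j, br j k = -br i j + ∑ k ∈ K, br j k := by
    rw [← h.antisymm, hK, Finset.erase_right_comm]
    exact (Finset.add_sum_erase _ _ (by simp [hij])).symm
  have hne : ∀ k ∈ K, k ≠ j ∧ k ≠ i := by simp [hK]
  have hprod : (∑ k ∈ K, br i k) * (∑ k ∈ K, br j k) - (∑ k ∈ K, br j k) * (∑ k ∈ K, br i k) =
      ∑ k ∈ K, (br i k * br j k - br j k * br i k) := by
    rw [Finset.sum_mul_sum, Finset.sum_mul_sum, Finset.sum_comm (s := K) (t := K)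
      (f := fun a b => br j a * br i b), ← Finset.sum_sub_distrib]
    refine Finset.sum_congr rfl fun k hk => ?_
    rw [← Finset.sum_sub_distrib]
    -- For `l ≠ k` the brackets `[ik]` and `[jl]` have disjoint indices, so only the diagonal
    -- survives.
    refine Finset.sum_eq_single_of_mem k hk fun l hl hlk => ?_
    have hk' := hne k hk
    have hl' := hne l hl
    rw [(h.comm i k j l hk'.2.symm hl'.1.symm hij hl'.2.symm hk'.1 hlk.symm).eq, sub_self]
  have hcancel : ∑ k ∈ K, (br i k * br j k - br j k * br i k) +
      (br i j * (∑ k ∈ K, br j k) - (∑ k ∈ K, br j k) * br i j) +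
      (br i j * (∑ k ∈ K, br i k) - (∑ k ∈ K, br i k) * br i j) = 0 := by
    simp only [Finset.mul_sum, Finset.sum_mul, ← Finset.sum_sub_distrib, ← Finset.sum_add_distrib]
    refine Finset.sum_eq_zero fun k hk => ?_
    have hk' := hne k hk
    -- The exchange rule, used once as it is and once with `i` and `j` swapped, writes the
    -- commutator of `[ik]` and `[jk]` as minus the commutators of `[ij]` with `[ik]` and `[jk]`.
    have h1 := h.mul_eq hij hk'.2.symm hk'.1.symm
    have h2 := h.mul_eq hij.symm hk'.1.symm hk'.2.symm
    rw [h.antisymm i j] at h2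
    rw [h1, h2]
    noncomm_ring
  rw [hi, hj, commute_iff_eq, ← sub_eq_zero, ← hcancel, ← hprod]
  noncomm_ring

end general

end IsFKFamily

/-! ### Geometric series in square-zero variables -/

section series

variable {ι Λ B : Type*} [DecidableEq ι] [CommRing Λ] [Ring B] [Algebra Λ B]

/-- The inverse of `1 - ∑ tₐ xₐ`, which exists for square-zero parameters `tₐ`. -/
noncomputable def geomSeries (t : ι → Λ) (x : ι → B) (I : Finset ι) : B :=
  Ring.inverse (1 - ∑ a ∈ I, t a • x a)

variable {t : ι → Λ} (ht : ∀ a, t a * t a = 0) (x : ι → B)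

/-- First-order perturbation of an inverse, exact because `c² = 0`. -/
theorem mul_eq_one_insert {c : Λ} (hc : c * c = 0) {u v y : B} (h1 : u * v = 1)
    (h2 : v * u = 1) :
    (u - c • y) * (v + c • (v * y * v)) = 1 ∧ (v + c • (v * y * v)) * (u - c • y) = 1 := by
  have hz : ∀ z : B, c • c • z = 0 := fun z => by rw [smul_smul, hc, zero_smul]
  have h3 : ∀ z, u * (v * z) = z := fun z => by rw [← mul_assoc, h1, one_mul]
  constructor
  · simp only [sub_mul, mul_add, smul_mul_assoc, mul_smul_comm, h1, hz, mul_assoc, h3, smul_sub,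
      sub_zero, sub_add_cancel]
  · simp only [mul_sub, add_mul, smul_mul_assoc, mul_smul_comm, h2, hz, mul_assoc, mul_one,
      smul_add, add_zero, add_sub_cancel_right]

include ht

theorem isUnit_one_sub_sum (I : Finset ι) : IsUnit (1 - ∑ a ∈ I, t a • x a) := by
  induction I using Finset.induction_on with
  | empty => simp
  | insert e I he ih =>
    obtain ⟨⟨u, v, h1, h2⟩, hu⟩ := ih
    simp only at hu
    subst hu
    rw [Finset.sum_insert he, add_comm, ← sub_sub]
    obtain ⟨h3, h4⟩ := mul_eq_one_insert (ht e) (y := x e) h1 h2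
    exact ⟨⟨_, _, h3, h4⟩, rfl⟩

theorem one_sub_mul_geomSeries (I : Finset ι) :
    (1 - ∑ a ∈ I, t a • x a) * geomSeries t x I = 1 :=
  Ring.mul_inverse_cancel _ (isUnit_one_sub_sum ht x I)

theorem geomSeries_mul_one_sub (I : Finset ι) :
    geomSeries t x I * (1 - ∑ a ∈ I, t a • x a) = 1 :=
  Ring.inverse_mul_cancel _ (isUnit_one_sub_sum ht x I)

theorem geomSeries_eq_left (I : Finset ι) :
    geomSeries t x I = 1 + (∑ a ∈ I, t a • x a) * geomSeries t x I := by
  have := one_sub_mul_geomSeries ht x I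
  rw [sub_mul, one_mul, sub_eq_iff_eq_add] at this
  exact this

theorem geomSeries_eq_right (I : Finset ι) :
    geomSeries t x I = 1 + geomSeries t x I * ∑ a ∈ I, t a • x a := by
  have := geomSeries_mul_one_sub ht x I
  rw [mul_sub, mul_one, sub_eq_iff_eq_add] at this
  exact this

theorem geomSeries_insert {e : ι} {I : Finset ι} (he : e ∉ I) :
    geomSeries t x (insert e I) =
      geomSeries t x I + t e • (geomSeries t x I * x e * geomSeries t x I) := by
  obtain ⟨h3, -⟩ := mul_eq_one_insert (ht e) (y := x e) (one_sub_mul_geomSeries ht x I)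
    (geomSeries_mul_one_sub ht x I)
  refine left_inv_eq_right_inv (geomSeries_mul_one_sub ht x (insert e I)) ?_
  rwa [Finset.sum_insert he, add_comm, ← sub_sub]

/-- Every word containing `xₑ` already carries `tₑ`, so multiplication by `tₑ` kills it. -/
theorem smul_geomSeries_erase (e : ι) (I : Finset ι) :
    t e • geomSeries t x (I.erase e) = t e • geomSeries t x I := by
  by_cases he : e ∈ I
  · conv_rhs => rw [← Finset.insert_erase he, geomSeries_insert ht x (Finset.notMem_erase e I),
      smul_add, smul_smul, ht e, zero_smul, add_zero]
  · rw [Finset.erase_eq_of_notMem he]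

theorem smul_mul_geomSeries_erase (e : ι) (I : Finset ι) (u v : B) :
    t e • (u * (geomSeries t x (I.erase e) * v)) = t e • (u * (geomSeries t x I * v)) := by
  rw [← mul_smul_comm, ← smul_mul_assoc, smul_geomSeries_erase ht, smul_mul_assoc, mul_smul_comm]

theorem Commute.geomSeries_right {y : B} {I : Finset ι} (h : Commute y (∑ a ∈ I, t a • x a)) :
    Commute y (geomSeries t x I) := by
  have h' : Commute y (1 - ∑ a ∈ I, t a • x a) := (Commute.one_right y).sub_right h
  calc y * geomSeries t x I
      = geomSeries t x I * ((1 - ∑ a ∈ I, t a • x a) * y) * geomSeries t x I := by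
        rw [← mul_assoc, geomSeries_mul_one_sub ht, one_mul]
    _ = geomSeries t x I * y := by
        rw [← h'.eq, mul_assoc, mul_assoc, one_sub_mul_geomSeries ht, mul_one]

theorem commute_geomSeries {y : B} {I : Finset ι} (h : ∀ a ∈ I, Commute y (x a)) :
    Commute y (geomSeries t x I) :=
  Commute.geomSeries_right ht x (Commute.sum_right _ _ _ fun a ha => (h a ha).smul_right _)

/-- An element `tₑ y` commutes with the series as soon as `y` commutes with all `xₐ`, `a ≠ e`. -/
theorem commute_smul_geomSeries {e : ι} {y : B} {I : Finset ι}
    (h : ∀ a ∈ I, a ≠ e → Commute y (x a)) : Commute (t e • y) (geomSeries t x I) := by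
  refine Commute.geomSeries_right ht x (Commute.sum_right _ _ _ fun a ha => ?_)
  rcases eq_or_ne a e with rfl | hne
  · change _ * _ = _ * _
    simp only [smul_mul_assoc, mul_smul_comm, smul_smul, ht, zero_smul]
  · exact ((h a ha hne).smul_right _).smul_left _

/-- In the presence of `tₑ` the term `xₑ` is invisible, so `y` passes through the series even if it
fails to commute with `xₑ`. This is how brackets sharing an index are moved. -/
theorem smul_mul_geomSeries {e : ι} {y : B} {I : Finset ι}
    (h : ∀ a ∈ I, a ≠ e → Commute y (x a)) (z : B) :
    t e • (y * (geomSeries t x I * z)) = t e • (geomSeries t x I * (y * z)) := by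
  have := (commute_smul_geomSeries ht x h).eq
  rw [smul_mul_assoc, mul_smul_comm] at this
  rw [← mul_assoc, ← smul_mul_assoc, this, smul_mul_assoc, mul_assoc]

end series

/-! ### Generating series of words with a fixed second index -/

namespace IsFKFamily

section series

variable {ι Λ B : Type*} [DecidableEq ι] [CommRing Λ] [Ring B] [Algebra Λ B]
  {p : ι → ι → Λ} {br : ι → ι → B} {t : ι → Λ}

/-- The generating series `∑ [a₁ b] ⋯ [a_k b]` over distinct `a₁, …, a_k ∈ I`, each word being
weighted with the product of the parameters `tₐ`. -/
noncomputable abbrev W (br : ι → ι → B) (t : ι → Λ) (I : Finset ι) (b : ι) : B :=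
  geomSeries t (fun a => br a b) I

theorem W_eq_left (ht : ∀ a, t a * t a = 0) (I : Finset ι) (b : ι) :
    W br t I b = 1 + (∑ a ∈ I, t a • br a b) * W br t I b :=
  geomSeries_eq_left ht _ I

theorem W_eq_right (ht : ∀ a, t a * t a = 0) (I : Finset ι) (b : ι) :
    W br t I b = 1 + W br t I b * ∑ a ∈ I, t a • br a b :=
  geomSeries_eq_right ht _ I

theorem W_insert (ht : ∀ a, t a * t a = 0) {I : Finset ι} {e : ι} (he : e ∉ I) (b : ι) :
    W br t (insert e I) b = W br t I b + t e • (W br t I b * br e b * W br t I b) :=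
  geomSeries_insert ht _ he

/-- For `b ≠ c`, the only letter of `W b` that may fail to commute with `[ac]` is `[ab]`, and both
carry `tₐ`. -/
theorem commute_W (h : IsFKFamily p br) (ht : ∀ a, t a * t a = 0) {I : Finset ι} {b c : ι}
    (hb : b ∉ I) (hc : c ∉ I) : Commute (W br t I b) (W br t I c) := by
  rcases eq_or_ne b c with rfl | hbc
  · exact Commute.refl _
  refine Commute.geomSeries_right ht _ (Commute.sum_right _ _ _ fun a ha => Commute.symm ?_)
  refine commute_smul_geomSeries ht _ fun a' ha' hne => ?_
  exact h.comm _ _ _ _ (ne_of_mem_of_not_mem ha hc) (ne_of_mem_of_not_mem ha' hb) hne.symm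
    (ne_of_mem_of_not_mem ha hb) (ne_of_mem_of_not_mem ha' hc).symm hbc.symm

/-- Moving `[jl]` through the series of `l`. -/
theorem mul_W (h : IsFKFamily p br) (ht : ∀ a, t a * t a = 0) {I : Finset ι} {j l : ι}
    (hj : j ∉ I) (hl : l ∉ I) (hjl : j ≠ l) :
    br j l * W br t I l = W br t I j * br j l -
      ∑ i ∈ I, t i • (br i l * (W br t I l * (W br t I j * br i j))) := by
  -- The three-term relation for `i, j, l`, summed over `i`; multiplying by `W j` on the left and `W
  -- l` on the right then gives the claim.
  have key : br j l * (1 - ∑ i ∈ I, t i • br i l) =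
      (1 - ∑ i ∈ I, t i • br i j) * br j l + ∑ i ∈ I, t i • (br i l * br i j) := by
    simp only [mul_sub, sub_mul, mul_one, one_mul, Finset.mul_sum, Finset.sum_mul,
      mul_smul_comm, smul_mul_assoc]
    rw [sub_add, ← Finset.sum_sub_distrib]
    congr 1
    refine Finset.sum_congr rfl fun i hi => ?_
    have hij := ne_of_mem_of_not_mem hi hj
    have hil := ne_of_mem_of_not_mem hi hl
    rw [h.mul_eq hij.symm hjl hil, h.antisymm i j, ← smul_sub]
    congr 1
    noncomm_ring
  have key2 : W br t I j * (br j l * (1 - ∑ i ∈ I, t i • br i l)) * W br t I l =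
      br j l * W br t I l + ∑ i ∈ I, t i • (br i l * (W br t I l * (W br t I j * br i j))) := by
    rw [key, mul_add, ← mul_assoc, geomSeries_mul_one_sub ht, one_mul, add_mul]
    congr 1
    rw [Finset.mul_sum, Finset.sum_mul]
    refine Finset.sum_congr rfl fun i hi => ?_
    have hij := ne_of_mem_of_not_mem hi hj
    have hil := ne_of_mem_of_not_mem hi hl
    rw [mul_smul_comm, smul_mul_assoc, mul_assoc, mul_assoc, ← mul_assoc (W br t I l),
      (h.commute_W ht hl hj).eq]
    have h1 : ∀ a ∈ I, a ≠ i → Commute (br i l) (br a j) := fun a ha hne =>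
      h.comm _ _ _ _ hil (ne_of_mem_of_not_mem ha hj) hne.symm hij
        (ne_of_mem_of_not_mem ha hl).symm hjl.symm
    have h2 : ∀ a ∈ I, a ≠ i → Commute (br i j) (br a l) := fun a ha hne =>
      h.comm _ _ _ _ hij (ne_of_mem_of_not_mem ha hl) hne.symm hil
        (ne_of_mem_of_not_mem ha hj).symm hjl
    rw [mul_assoc (W br t I j), smul_mul_geomSeries ht _ h1]
    have h3 := smul_mul_geomSeries ht _ h2 1
    rw [mul_one, mul_one] at h3
    rw [← mul_smul_comm, ← mul_smul_comm, h3, mul_smul_comm, mul_smul_comm]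
  rw [eq_sub_iff_add_eq, ← key2]
  rw [mul_assoc, mul_assoc, one_sub_mul_geomSeries ht, mul_one]

/-! ### The cyclic relation -/

/-- The coefficient of `tₑ` in `∑ tᵢ [ij] W_j [ij]`. -/
noncomputable def cyc (br : ι → ι → B) (t : ι → Λ) (j : ι) (I : Finset ι) (e : ι) : B :=
  br e j * (W br t I j * br e j) +
    ∑ i ∈ I, t i • (br i j * (W br t I j * (br e j * (W br t I j * br i j))))

/-- The coefficient of `tₑ` in `∑ tᵢ pᵢⱼ Wᵢ`. -/
noncomputable def cycParam (p : ι → ι → Λ) (br : ι → ι → B) (t : ι → Λ) (j : ι) (I : Finset ι)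
    (e : ι) : B :=
  p e j • W br t I e +
    ∑ i ∈ I, t i • p i j • (W br t (I.erase i) i * (br e i * W br t (I.erase i) i))

/-- The factor `tₘ` allows `m` to be put back into the series and into the sum, the extra `i = m`
term having `tₘ² = 0`. -/
theorem smul_cyc_erase (ht : ∀ a, t a * t a = 0) (j : ι) {I : Finset ι} {m : ι} (hm : m ∈ I) :
    t m • cyc br t j (I.erase m) m = t m • (br m j * (W br t I j * br m j) +
      ∑ i ∈ I, t i • (br i j * (W br t I j * (br m j * (W br t I j * br i j))))) := by
  have hW : ∀ u v, t m • (u * (W br t (I.erase m) j * v)) = t m • (u * (W br t I j * v)) :=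
    fun u v => smul_mul_geomSeries_erase ht _ m I u v
  rw [cyc, smul_add, smul_add, hW, ← Finset.add_sum_erase I _ hm, smul_add _ (t m • _),
    smul_smul (t m) (t m), ht, zero_smul, zero_add, Finset.smul_sum, Finset.smul_sum]
  congr 1
  refine Finset.sum_congr rfl fun i _ => ?_
  rw [smul_comm, smul_comm (t m)]
  congr 1
  rw [hW]
  have := hW (br i j * (W br t I j * br m j)) (br i j)
  simpa only [mul_assoc] using this

/-- Expand the series next to `[ej]` by its first letter `[mj]` and exchange `[ej][mj] = [mj][em] -
[em][ej]`. In the first product `[em]` travels to the right end, giving the terms with `I ∖ m`; in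
the second it travels to the left end, where it cancels the factor `∑ tₘ[me]`. The constant `pₑⱼ` is
the empty word between the two copies of `[ej]`. -/
theorem cyc_rec (h : IsFKFamily p br) (ht : ∀ a, t a * t a = 0) {I : Finset ι} {j e : ι}
    (hj : j ∉ I) (he : e ∉ I) (hej : e ≠ j) :
    (1 - ∑ m ∈ I, t m • br m e) * cyc br t j I e =
      algebraMap Λ B (p e j) + ∑ m ∈ I, t m • (cyc br t j (I.erase m) m * br e m) := by
  have f1 : ∀ m ∈ I, br e j * br m j = br m j * br e m - br e m * br e j := fun m hm =>
    h.mul_eq (ne_of_mem_of_not_mem hm he).symm hej (ne_of_mem_of_not_mem hm hj)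
  have f2 : ∀ m ∈ I, ∀ u z, t m • (u * (br e m * (W br t I j * z))) =
      t m • (u * (W br t I j * (br e m * z))) := by
    intro m hm u z
    rw [← mul_smul_comm, smul_mul_geomSeries ht _ (fun a ha hne => ?_), mul_smul_comm]
    exact h.comm _ _ _ _ (ne_of_mem_of_not_mem hm he).symm (ne_of_mem_of_not_mem ha hj)
      (ne_of_mem_of_not_mem ha he).symm hej hne.symm (ne_of_mem_of_not_mem hm hj)
  have f3 : ∀ m ∈ I, ∀ i ∈ I, i ≠ m → br e m * br i j = br i j * br e m := fun m hm i hi hne =>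
    h.comm _ _ _ _ (ne_of_mem_of_not_mem hm he).symm (ne_of_mem_of_not_mem hi hj)
      (ne_of_mem_of_not_mem hi he).symm hej hne.symm (ne_of_mem_of_not_mem hm hj)
  have f4 : ∀ u v, u * (W br t I j * v) = u * v +
      ∑ m ∈ I, t m • (u * (br m j * (W br t I j * v))) := by
    intro u v
    conv_lhs => rw [W_eq_left ht]
    simp only [add_mul, one_mul, mul_add, Finset.sum_mul, Finset.mul_sum, smul_mul_assoc,
      mul_smul_comm, mul_assoc]
  have g1 : br e j * (W br t I j * br e j) = algebraMap Λ B (p e j) +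
      (∑ m ∈ I, t m • (br m j * (W br t I j * (br e m * br e j))) -
        ∑ m ∈ I, t m • (br e m * (br e j * (W br t I j * br e j)))) := by
    refine (f4 _ _).trans ?_
    rw [h.sq _ _ hej, ← Finset.sum_sub_distrib]
    congr 1
    refine Finset.sum_congr rfl fun m hm => ?_
    rw [← mul_assoc (br e j), f1 m hm, sub_mul, smul_sub, mul_assoc, mul_assoc, f2 m hm]
  have g2 : ∀ i ∈ I, t i • (br i j * (W br t I j * (br e j * (W br t I j * br i j)))) =
      t i • (br i j * (W br t I j * (br i j * br e i))) -
      t i • (br i j * (W br t I j * (br e i * br e j))) +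
      (∑ m ∈ I, t m • t i • (br i j * (W br t I j * (br m j * (W br t I j * (br i j * br e m))))) -
       ∑ m ∈ I, t m • t i •
        (br e m * (br i j * (W br t I j * (br e j * (W br t I j * br i j)))))) := by
    intro i hi
    refine (congrArg (fun z => t i • (br i j * (W br t I j * z)))
      (f4 (br e j) (br i j))).trans ?_
    rw [f1 i hi, ← Finset.sum_sub_distrib]
    simp only [mul_add, mul_sub, smul_add, smul_sub, Finset.mul_sum, Finset.smul_sum]
    congr 1
    refine Finset.sum_congr rfl fun m hm => ?_
    -- The diagonal terms vanish through `tᵢ² = 0`; off the diagonal `[em]` and `[ij]` commute.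
    rcases eq_or_ne i m with rfl | hne
    · simp only [mul_smul_comm, smul_smul, ht, zero_smul, sub_zero]
    · rw [← mul_assoc (br e j), f1 m hm, sub_mul]
      simp only [mul_smul_comm, mul_sub, smul_sub, mul_assoc]
      rw [smul_comm (t i) (t m), smul_comm (t i) (t m)]
      congr 1
      · rw [smul_comm (t m), smul_comm (t m)]
        congr 1
        have := f2 m hm (br i j * (W br t I j * br m j)) (br i j)
        simp only [mul_assoc] at this
        rw [this, f3 m hm i hi hne]
      · rw [smul_comm (t m), smul_comm (t m)]
        congr 1
        have := f2 m hm (br i j) (br e j * (W br t I j * br i j))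
        rw [← this, ← mul_assoc (br i j), ← f3 m hm i hi hne, mul_assoc]
  have g3 : ∑ m ∈ I, t m • (cyc br t j (I.erase m) m * br e m) =
      ∑ m ∈ I, t m • (br m j * (W br t I j * (br m j * br e m))) +
      ∑ i ∈ I, ∑ m ∈ I, t m • t i •
        (br i j * (W br t I j * (br m j * (W br t I j * (br i j * br e m))))) := by
    rw [Finset.sum_comm, ← Finset.sum_add_distrib]
    refine Finset.sum_congr rfl fun m hm => ?_
    rw [← smul_mul_assoc, smul_cyc_erase ht j hm]
    simp only [smul_add, add_mul, smul_mul_assoc, Finset.smul_sum, Finset.sum_mul, mul_assoc]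
  have g4 : (∑ m ∈ I, t m • br m e) * cyc br t j I e =
      -∑ m ∈ I, t m • (br e m * (br e j * (W br t I j * br e j))) -
      ∑ i ∈ I, ∑ m ∈ I, t m • t i •
        (br e m * (br i j * (W br t I j * (br e j * (W br t I j * br i j))))) := by
    rw [Finset.sum_comm, cyc, Finset.sum_mul, ← Finset.sum_neg_distrib, ← Finset.sum_sub_distrib]
    refine Finset.sum_congr rfl fun m hm => ?_
    rw [h.antisymm e m]
    simp only [mul_add, smul_mul_assoc, neg_mul, smul_neg, Finset.mul_sum,
      mul_smul_comm, sub_eq_add_neg, Finset.sum_neg_distrib]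
    congr 2
    exact Finset.sum_congr rfl fun i _ => smul_comm _ _ _
  rw [sub_mul, one_mul, g4, g3, show cyc br t j I e = _ from
    congrArg₂ (· + ·) g1 (Finset.sum_congr rfl g2)]
  simp only [Finset.sum_add_distrib, Finset.sum_sub_distrib]
  abel

/-- By `mul_W`, a factor `W e` can be extracted on the left of the middle expression, and `1 - ∑
tₘ[me]` is its inverse. -/
theorem one_sub_mul_W_mul_W (h : IsFKFamily p br) (ht : ∀ a, t a * t a = 0) {I : Finset ι}
    {i e : ι} (hi : i ∉ I) (he : e ∉ I) (hei : e ≠ i) :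
    (1 - ∑ m ∈ I, t m • br m e) * (W br t I i * (br e i * W br t I i)) =
      W br t I i * br e i +
        ∑ m ∈ I, t m • (W br t I i * (br m i * (W br t I i * br e m))) := by
  have hc := (h.commute_W ht hi he).eq
  have key : W br t I i * (br e i * W br t I i) = W br t I e * (W br t I i * br e i +
      ∑ m ∈ I, t m • (W br t I i * (br m i * (W br t I i * br e m)))) := by
    rw [h.mul_W ht he hi hei, mul_sub, mul_add, ← mul_assoc, ← mul_assoc, hc, sub_eq_add_neg,
      Finset.mul_sum, Finset.mul_sum, ← Finset.sum_neg_distrib]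
    congr 1
    refine Finset.sum_congr rfl fun m hm => ?_
    have h1 : ∀ a ∈ I, a ≠ m → Commute (br m i) (br a e) := fun a ha hne =>
      h.comm _ _ _ _ (ne_of_mem_of_not_mem hm hi) (ne_of_mem_of_not_mem ha he) hne.symm
        (ne_of_mem_of_not_mem hm he) (ne_of_mem_of_not_mem ha hi).symm hei.symm
    have h2 := smul_mul_geomSeries ht _ h1 (W br t I i * br e m)
    rw [mul_smul_comm, mul_smul_comm, ← mul_assoc (W br t I e), ← hc, mul_assoc,
      ← mul_smul_comm (t m) (W br t I i) (W br t I e * _), ← h2,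
      ← mul_assoc (W br t I e), ← hc, h.antisymm e m]
    simp only [mul_neg, neg_neg, smul_neg, mul_assoc, mul_smul_comm]
  rw [key, ← mul_assoc, one_sub_mul_geomSeries ht, one_mul]

/-- The same recursion as for `cyc`. In the `i`-th summand `tᵢ` removes `[ie]` from the left factor,
so `one_sub_mul_W_mul_W` applies with `I ∖ i`; the leading term `pₑⱼ W e` simply loses its series.
-/
theorem cycParam_rec (h : IsFKFamily p br) (ht : ∀ a, t a * t a = 0) {I : Finset ι} {j e : ι}
    (he : e ∉ I) :
    (1 - ∑ m ∈ I, t m • br m e) * cycParam p br t j I e =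
      algebraMap Λ B (p e j) + ∑ m ∈ I, t m • (cycParam p br t j (I.erase m) m * br e m) := by
  have h1 : ∀ i ∈ I, t i • p i j • ((1 - ∑ m ∈ I, t m • br m e) *
        (W br t (I.erase i) i * (br e i * W br t (I.erase i) i))) =
      t i • p i j • (W br t (I.erase i) i * br e i) + ∑ m ∈ I.erase i, t m • t i • p i j •
        (W br t (I.erase i) i * (br m i * (W br t (I.erase i) i * br e m))) := by
    intro i hi
    rw [smul_comm, ← smul_mul_assoc, smul_sub, ← Finset.add_sum_erase I _ hi, smul_add,
      smul_smul (t i) (t i), ht, zero_smul, zero_add, ← smul_sub, smul_mul_assoc,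
      h.one_sub_mul_W_mul_W ht (Finset.notMem_erase i I)
        (fun hh => he (Finset.mem_of_mem_erase hh)) (ne_of_mem_of_not_mem hi he).symm,
      smul_comm, smul_add, smul_add, Finset.smul_sum, Finset.smul_sum]
    congr 1
    refine Finset.sum_congr rfl fun m _ => ?_
    rw [smul_comm _ (t m), smul_comm _ (t m)]
  have h2 : ∀ m ∈ I, t m • (cycParam p br t j (I.erase m) m * br e m) =
      t m • p m j • (W br t (I.erase m) m * br e m) + ∑ i ∈ I.erase m, t m • t i • p i j •
        (W br t (I.erase i) i * (br m i * (W br t (I.erase i) i * br e m))) := by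
    intro m hm
    rw [cycParam, add_mul, smul_add, smul_mul_assoc, Finset.sum_mul, Finset.smul_sum]
    congr 1
    refine Finset.sum_congr rfl fun i _ => ?_
    rw [smul_mul_assoc, smul_mul_assoc, smul_comm (t m), smul_comm (t m), smul_comm (t m) (t i),
      smul_comm (t m)]
    congr 2
    have := smul_mul_geomSeries_erase ht (fun a => br a i) m (I.erase i)
    rw [Finset.erase_right_comm]
    have h3 := this 1 (br m i * (W br t ((I.erase i).erase m) i * br e m))
    have h4 := this (W br t (I.erase i) i * br m i) (br e m)
    simp only [one_mul, mul_assoc] at h3 h4 ⊢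
    rw [h3, h4]
  rw [Finset.sum_congr rfl h2, Finset.sum_add_distrib, cycParam, mul_add, mul_smul_comm,
    one_sub_mul_geomSeries ht, ← Algebra.algebraMap_eq_smul_one, Finset.mul_sum]
  simp only [mul_smul_comm]
  rw [Finset.sum_congr rfl h1, Finset.sum_add_distrib]
  congr 2
  exact Finset.sum_comm' (by intro x y; simp only [Finset.mem_erase]; tauto)

/-- Both sides obey the same recursion in terms of smaller sets, and its left factor is a unit. -/
theorem cyc_eq_cycParam (h : IsFKFamily p br) (ht : ∀ a, t a * t a = 0) (j : ι)
    (I : Finset ι) : ∀ e, j ∉ I → e ∉ I → e ≠ j → cyc br t j I e = cycParam p br t j I e := by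
  induction hc : I.card using Nat.strong_induction_on generalizing I with
  | _ c ih =>
  subst hc
  intro e hj he hej
  refine (isUnit_one_sub_sum ht (fun m => br m e) I).mul_left_cancel ?_
  rw [h.cyc_rec ht hj he hej, h.cycParam_rec ht he]
  congr 1
  refine Finset.sum_congr rfl fun m hm => ?_
  rw [ih _ (Finset.card_erase_lt_of_mem hm) _ rfl m (fun h => hj (Finset.mem_of_mem_erase h))
    (Finset.notMem_erase m I) (ne_of_mem_of_not_mem hm hj)]

theorem smul_mul_cyc (ht : ∀ a, t a * t a = 0) {I : Finset ι} {j e : ι} (he : e ∉ I) :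
    ∑ i ∈ insert e I, t i • (br i j * (W br t (insert e I) j * br i j)) =
      ∑ i ∈ I, t i • (br i j * (W br t I j * br i j)) + t e • cyc br t j I e := by
  have hz : ∀ z : B, t e • t e • z = 0 := fun z => by rw [smul_smul, ht, zero_smul]
  rw [Finset.sum_insert he, W_insert ht he, cyc]
  simp only [add_mul, mul_add, smul_add, smul_mul_assoc, mul_smul_comm, hz, add_zero,
    Finset.sum_add_distrib, Finset.smul_sum, mul_assoc, smul_comm (t e)]
  abel

theorem sum_smul_W_insert (ht : ∀ a, t a * t a = 0) {I : Finset ι} {j e : ι} (he : e ∉ I) :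
    ∑ i ∈ insert e I, t i • p i j • W br t ((insert e I).erase i) i =
      ∑ i ∈ I, t i • p i j • W br t (I.erase i) i + t e • cycParam p br t j I e := by
  rw [Finset.sum_insert he, Finset.erase_insert he, cycParam, smul_add, Finset.smul_sum,
    add_left_comm, ← Finset.sum_add_distrib]
  congr 1
  refine Finset.sum_congr rfl fun i hi => ?_
  rw [Finset.erase_insert_of_ne (ne_of_mem_of_not_mem hi he).symm,
    W_insert ht (fun hh => he (Finset.mem_of_mem_erase hh)), smul_add, smul_add,
    smul_comm (p i j) (t e), smul_comm (t i) (t e), mul_assoc]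

/-- The cyclic relation: `∑ [a₁ j] ⋯ [a_r j] [a₁ j]` over all orderings of a set. -/
theorem sum_mul_W_mul (h : IsFKFamily p br) (ht : ∀ a, t a * t a = 0) {I : Finset ι} {j : ι}
    (hj : j ∉ I) :
    ∑ i ∈ I, t i • (br i j * (W br t I j * br i j)) =
      ∑ i ∈ I, t i • p i j • W br t (I.erase i) i := by
  induction I using Finset.induction_on with
  | empty => simp
  | insert e I he ih =>
    simp only [Finset.mem_insert, not_or] at hj
    rw [smul_mul_cyc ht he, sum_smul_W_insert ht he, ih hj.2,
      h.cyc_eq_cycParam ht j I e hj.2 he (Ne.symm hj.1)]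

/-! ### Products of the generating series -/

/-- The product of the generating series over a list of second indices. -/
noncomputable def prodW (br : ι → ι → B) (t : ι → Λ) (I : Finset ι) (L : List ι) : B :=
  (L.map (W br t I)).prod

omit [DecidableEq ι] in
theorem prodW_cons (I : Finset ι) (b : ι) (L : List ι) :
    prodW br t I (b :: L) = W br t I b * prodW br t I L := by
  simp [prodW]

omit [DecidableEq ι] in
theorem prodW_append (I : Finset ι) (L L' : List ι) :
    prodW br t I (L ++ L') = prodW br t I L * prodW br t I L' := by
  simp [prodW]

omit [DecidableEq ι] in
theorem prodW_singleton (I : Finset ι) (b : ι) : prodW br t I [b] = W br t I b := by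
  simp [prodW]

omit [DecidableEq ι] in
theorem commute_prodW {I : Finset ι} {y : B} {L : List ι}
    (h : ∀ b ∈ L, Commute y (W br t I b)) : Commute y (prodW br t I L) := by
  refine Commute.list_prod_right _ _ fun z hz => ?_
  obtain ⟨b, hb, rfl⟩ := List.mem_map.1 hz
  exact h b hb

/-- At most one factor can contribute `tₑ`. The resulting `[el] W l` commutes with the factors of
the other second indices, hence can be collected at the right end. -/
theorem prodW_insert (h : IsFKFamily p br) (ht : ∀ a, t a * t a = 0) {I : Finset ι} {e : ι}
    (he : e ∉ I) {L : List ι} (hL : L.Nodup) (heL : e ∉ L) (hIL : ∀ b ∈ L, b ∉ I) :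
    prodW br t (insert e I) L = prodW br t I L +
      t e • (prodW br t I L * (L.map fun l => br e l * W br t I l).sum) := by
  induction L with
  | nil => simp [prodW]
  | cons b L ih =>
    rw [List.nodup_cons] at hL
    simp only [List.mem_cons, not_or, forall_eq_or_imp] at heL hIL
    have hz : ∀ z : B, t e • t e • z = 0 := fun z => by rw [smul_smul, ht, zero_smul]
    have hW : Commute (W br t I b) (prodW br t I L) :=
      commute_prodW fun l hl => h.commute_W ht hIL.1 (hIL.2 l hl)
    have hb : Commute (br e b) (prodW br t I L) :=
      commute_prodW fun l hl => commute_geomSeries ht _ fun a ha =>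
        h.comm _ _ _ _ heL.1 (ne_of_mem_of_not_mem ha (hIL.2 l hl))
          (ne_of_mem_of_not_mem ha he).symm (ne_of_mem_of_not_mem hl heL.2).symm
          (ne_of_mem_of_not_mem ha hIL.1).symm (ne_of_mem_of_not_mem hl hL.1).symm
    rw [prodW_cons, prodW_cons, ih hL.2 heL.2 hIL.2, W_insert ht he, List.map_cons,
      List.sum_cons]
    simp only [add_mul, mul_add, smul_add, smul_mul_assoc, mul_smul_comm, hz, add_zero,
      mul_assoc]
    rw [hW.eq, ← mul_assoc (br e b), hb.eq, mul_assoc]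
    abel

theorem smul_prodW_erase (ht : ∀ a, t a * t a = 0) (e : ι) (I : Finset ι) (L : List ι) :
    t e • prodW br t (I.erase e) L = t e • prodW br t I L := by
  induction L with
  | nil => rfl
  | cons b L ih =>
    rw [prodW_cons, prodW_cons, ← smul_mul_assoc, smul_geomSeries_erase ht, smul_mul_assoc,
      ← mul_smul_comm, ih, mul_smul_comm]

theorem smul_sum_erase (ht : ∀ a, t a * t a = 0) (e : ι) (I : Finset ι) (L : List ι) :
    t e • (L.map fun l => br e l * W br t (I.erase e) l).sum =
      t e • (L.map fun l => br e l * W br t I l).sum := by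
  induction L with
  | nil => rfl
  | cons b L ih =>
    rw [List.map_cons, List.map_cons, List.sum_cons, List.sum_cons, smul_add, smul_add, ih,
      ← mul_smul_comm, smul_geomSeries_erase ht, mul_smul_comm]

/-- Summing `mul_W` over the list produces `W j` times the part of `θ_j` outside `I`, plus
corrections ending in `[ij]`. -/
theorem sum_map_mul_W (h : IsFKFamily p br) (ht : ∀ a, t a * t a = 0) {I : Finset ι} {j : ι}
    (hj : j ∉ I) {L : List ι} (hjL : j ∉ L) (hIL : ∀ b ∈ L, b ∉ I) :
    (L.map fun l => br j l * W br t I l).sum = W br t I j * (L.map fun l => br j l).sum -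
      ∑ i ∈ I, t i • ((L.map fun l => br i l * W br t I l).sum * (W br t I j * br i j)) := by
  induction L with
  | nil => simp
  | cons b L ih =>
    simp only [List.mem_cons, not_or, forall_eq_or_imp] at hjL hIL
    simp only [List.map_cons, List.sum_cons, add_mul, mul_add, smul_add, Finset.sum_add_distrib]
    rw [ih hjL.2 hIL.2, h.mul_W ht hj hIL.1 hjL.1]
    simp only [mul_assoc]
    abel

/-- The difference consists of the words using the letter `i`; erasures of `i` can be undone under
`tᵢ`. -/
theorem prodW_sub_erase (h : IsFKFamily p br) (ht : ∀ a, t a * t a = 0) {I : Finset ι} {i : ι}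
    (hi : i ∈ I) {L : List ι} (hL : L.Nodup) (hIL : ∀ b ∈ L, b ∉ I) :
    prodW br t I L - prodW br t (I.erase i) L =
      t i • (prodW br t I L * (L.map fun l => br i l * W br t I l).sum) := by
  have := h.prodW_insert ht (Finset.notMem_erase i I) hL (fun hh => hIL i hh hi)
    (fun b hb hh => hIL b hb (Finset.mem_of_mem_erase hh))
  rw [Finset.insert_erase hi] at this
  rw [sub_eq_iff_eq_add', this]
  congr 1
  rw [← this, ← smul_mul_assoc, smul_prodW_erase ht, smul_mul_assoc, ← mul_smul_comm,
    smul_sum_erase ht, mul_smul_comm]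

/-- The generating function form of the recursion for deformed elementary symmetric
polynomials. -/
theorem prodW_insert_eq (h : IsFKFamily p br) (ht : ∀ a, t a * t a = 0) {I : Finset ι} {j : ι}
    (hj : j ∉ I) {L : List ι} (hL : L.Nodup) (hjL : j ∉ L) (hIL : ∀ b ∈ L, b ∉ I) :
    prodW br t (insert j I) L = prodW br t I L +
      t j • (prodW br t I (L ++ [j]) * (L.map fun l => br j l).sum -
        ∑ i ∈ I, (prodW br t I (L ++ [j]) - prodW br t (I.erase i) (L ++ [j])) * br i j +
        ∑ i ∈ I, t i • p i j • prodW br t (I.erase i) (L ++ [j, i])) := by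
  have hLj : (L ++ [j]).Nodup := by
    rw [← List.concat_eq_append]; exact hL.concat hjL
  have hILj : ∀ b ∈ L ++ [j], b ∉ I := by
    simp only [List.mem_append, List.mem_singleton]
    rintro b (hb | rfl)
    exacts [hIL b hb, hj]
  have hcyc : ∑ i ∈ I, t i • p i j • prodW br t (I.erase i) (L ++ [j, i]) =
      ∑ i ∈ I, t i • (prodW br t I (L ++ [j]) * (br i j * (W br t I j * br i j))) := by
    have hfac : ∑ i ∈ I, t i • (prodW br t I (L ++ [j]) * (br i j * (W br t I j * br i j))) =
        prodW br t I (L ++ [j]) * ∑ i ∈ I, t i • (br i j * (W br t I j * br i j)) := by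
      simp only [Finset.mul_sum, mul_smul_comm]
    rw [hfac, h.sum_mul_W_mul ht hj, Finset.mul_sum]
    refine Finset.sum_congr rfl fun i _ => ?_
    rw [show L ++ [j, i] = (L ++ [j]) ++ [i] by simp, prodW_append _ (L ++ [j]),
      prodW_singleton, smul_comm (t i), smul_comm (t i), ← smul_mul_assoc (t i),
      smul_prodW_erase ht, smul_mul_assoc, mul_smul_comm, mul_smul_comm]
  have hcomm : ∀ i ∈ I, t i • (W br t I j * (L.map fun l => br i l * W br t I l).sum) =
      t i • ((L.map fun l => br i l * W br t I l).sum * W br t I j) := by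
    intro i hi
    rw [← List.sum_map_mul_left, ← List.sum_map_mul_right, List.smul_sum, List.smul_sum,
      List.map_map, List.map_map]
    congr 1
    refine List.map_congr_left fun l hl => ?_
    have h1 : ∀ a ∈ I, a ≠ i → Commute (br i l) (br a j) := fun a ha hne =>
      h.comm _ _ _ _ (ne_of_mem_of_not_mem hi (hIL l hl)) (ne_of_mem_of_not_mem ha hj) hne.symm
        (ne_of_mem_of_not_mem hi hj) (ne_of_mem_of_not_mem ha (hIL l hl)).symm
        (ne_of_mem_of_not_mem hl hjL)
    have h2 := smul_mul_geomSeries ht _ h1 (W br t I l)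
    simp only [Function.comp_apply]
    rw [← h2, mul_assoc, (h.commute_W ht hj (hIL l hl)).eq]
  have hΦ : prodW br t I (L ++ [j]) = prodW br t I L * W br t I j := by
    rw [prodW_append, prodW_singleton]
  rw [h.prodW_insert ht hj hL hjL hIL]
  congr 2
  rw [h.sum_map_mul_W ht hj hjL hIL, hcyc, mul_sub, ← mul_assoc, ← hΦ,
    sub_add, ← Finset.sum_sub_distrib, Finset.mul_sum]
  congr 1
  -- The words using `i` are split by its second index: an index in `L` gives the correction from
  -- `sum_map_mul_W`, while the index `j` gives `[ij] W_I(j) [ij]`, which cancels the cyclic term.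
  refine Finset.sum_congr rfl fun i hi => ?_
  rw [h.prodW_sub_erase ht hi hLj hILj, hΦ, List.map_append,
    List.sum_append, List.map_singleton, List.sum_singleton]
  simp only [mul_add, add_mul, smul_add, smul_mul_assoc, mul_assoc, mul_smul_comm,
    add_sub_cancel_right]
  have h3 := congrArg (fun z => prodW br t I L * (z * br i j)) (hcomm i hi)
  simpa only [smul_mul_assoc, mul_smul_comm, mul_assoc] using h3.symm

theorem prodW_append_singleton (ht : ∀ a, t a * t a = 0) (I : Finset ι) (j : ι) (L : List ι) :
    prodW br t I (L ++ [j]) =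
      prodW br t I L + ∑ i ∈ I, t i • (prodW br t (I.erase i) (L ++ [j]) * br i j) := by
  conv_lhs => rw [prodW_append, prodW_singleton, W_eq_right ht, mul_add, mul_one, ← mul_assoc,
    ← prodW_singleton (br := br) (t := t) I j, ← prodW_append, Finset.mul_sum]
  congr 1
  refine Finset.sum_congr rfl fun i _ => ?_
  rw [mul_smul_comm, ← smul_mul_assoc, ← smul_mul_assoc, smul_prodW_erase ht]

theorem prodW_cons_eq (ht : ∀ a, t a * t a = 0) (I : Finset ι) (b : ι) (L : List ι) :
    prodW br t I (b :: L) = prodW br t I L + ∑ a ∈ I, t a • (br a b * prodW br t I (b :: L)) := by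
  conv_lhs => rw [prodW_cons, W_eq_left ht, add_mul, one_mul, mul_assoc, ← prodW_cons]
  simp only [Finset.sum_mul, smul_mul_assoc]

end series

end IsFKFamily

/-! ### Adjoining square-zero variables -/

/-- An `R`-algebra `B` obtained from `A` by adjoining commuting central square-zero variables `tₐ`
(which live in `Λ`), with the functionals reading off the coefficients of squarefree monomials. -/
structure SqZeroExtension (ι R A Λ B : Type*) [DecidableEq ι] [CommRing R] [Ring A] [Algebra R A]
    [CommRing Λ] [Ring B] [Algebra R Λ] [Algebra R B] [Algebra Λ B] [IsScalarTower R Λ B] where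
  t : ι → Λ
  mul_self : ∀ a, t a * t a = 0
  incl : A →ₐ[R] B
  coeff : Finset ι → B →ₗ[R] A
  coeff_one : ∀ S, coeff S 1 = if S = ∅ then 1 else 0
  coeff_smul : ∀ S a x, coeff S (t a • x) = if a ∈ S then coeff (S.erase a) x else 0
  coeff_incl_mul : ∀ S y x, coeff S (incl y * x) = y * coeff S x
  coeff_mul_incl : ∀ S x y, coeff S (x * incl y) = coeff S x * y

namespace SqZeroExtension

section existence

universe u v w

variable (ι : Type u) (R : Type v) [DecidableEq ι] [CommRing R]

/-- Multiplication by `tₐ`, on coefficient functions. -/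
def varEnd (a : ι) : Module.End R (Finset ι → R) where
  toFun f S := if a ∈ S then f (S.erase a) else 0
  map_add' f g := by ext S; by_cases h : a ∈ S <;> simp [h]
  map_smul' c f := by ext S; by_cases h : a ∈ S <;> simp [h]

variable {ι}

theorem varEnd_apply (a : ι) (f : Finset ι → R) (S : Finset ι) :
    varEnd ι R a f S = if a ∈ S then f (S.erase a) else 0 := rfl

theorem varEnd_comm (a b : ι) : varEnd ι R a * varEnd ι R b = varEnd ι R b * varEnd ι R a := by
  ext1 f
  funext S
  change varEnd ι R a (varEnd ι R b f) S = varEnd ι R b (varEnd ι R a f) S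
  rcases eq_or_ne a b with rfl | hab
  · rfl
  · simp only [varEnd_apply, Finset.mem_erase, hab, hab.symm, ne_eq, not_false_eq_true, true_and]
    rw [Finset.erase_right_comm]
    split_ifs <;> rfl

/-- `Λ` is realised as the commutative algebra generated by the operators "multiply by `tₐ`" on
functions of finite sets. The coefficient at `S` is the value at `S` of an operator applied to the
constant monomial `δ`. -/
theorem exists_coeff : ∃ (Λ : Type (max u v)) (_ : CommRing Λ) (_ : Algebra R Λ) (t : ι → Λ)
    (c : Finset ι → Λ →ₗ[R] R), (∀ a, t a * t a = 0) ∧ (∀ S, c S 1 = if S = ∅ then 1 else 0) ∧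
      ∀ S a x, c S (t a * x) = if a ∈ S then c (S.erase a) x else 0 := by
  let s : Set (Module.End R (Finset ι → R)) := Set.range (varEnd ι R)
  have hs : ∀ a ∈ s, ∀ b ∈ s, a * b = b * a := by
    rintro _ ⟨a, rfl⟩ _ ⟨b, rfl⟩
    exact varEnd_comm R a b
  let δ : Finset ι → R := Pi.single ∅ 1
  have := Algebra.isMulCommutative_adjoin R hs
  refine ⟨Algebra.adjoin R s, { mul_comm := fun a b => mul_comm' a b }, inferInstance,
    fun a => ⟨varEnd ι R a, Algebra.subset_adjoin ⟨a, rfl⟩⟩,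
    fun S => (LinearMap.proj S ∘ₗ LinearMap.applyₗ δ) ∘ₗ (Algebra.adjoin R s).val.toLinearMap,
    fun a => ?_, fun S => ?_, fun S a x => ?_⟩
  · refine Subtype.ext ?_
    change varEnd ι R a * varEnd ι R a = 0
    ext1 f
    funext S
    change varEnd ι R a (varEnd ι R a f) S = 0
    simp [varEnd_apply]
  · change δ S = _
    simp [δ, Pi.single_apply]
  · rfl

-- The extension is `Λ ⊗ A`, with coefficients read off in the first factor.
open TensorProduct in
theorem exists_extension (A : Type w) [Ring A] [Algebra R A] :
    ∃ (Λ : Type (max u v)) (B : Type (max u v w)) (_ : CommRing Λ) (_ : Ring B)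
      (_ : Algebra R Λ) (_ : Algebra R B) (_ : Algebra Λ B) (_ : IsScalarTower R Λ B),
      Nonempty (SqZeroExtension ι R A Λ B) := by
  obtain ⟨Λ, _, _, t, c, ht, h1, hc⟩ := exists_coeff (ι := ι) R
  let C : Finset ι → Λ ⊗[R] A →ₗ[R] A := fun S =>
    (TensorProduct.lid R A).toLinearMap ∘ₗ LinearMap.rTensor A (c S)
  have hC : ∀ S l y, C S (l ⊗ₜ y) = c S l • y := fun S l y => by simp [C]
  refine ⟨Λ, Λ ⊗[R] A, inferInstance, inferInstance, inferInstance, inferInstance, inferInstance,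
    inferInstance, ⟨⟨t, ht, Algebra.TensorProduct.includeRight, C, ?_, ?_, ?_, ?_⟩⟩⟩
  · intro S
    rw [Algebra.TensorProduct.one_def, hC, h1]
    split_ifs <;> simp
  · intro S a x
    induction x using TensorProduct.induction_on with
    | zero => simp
    | tmul l y =>
      rw [TensorProduct.smul_tmul', smul_eq_mul, hC, hc, hC]
      split_ifs <;> simp
    | add x y hx hy =>
      rw [smul_add, map_add, hx, hy]
      split_ifs <;> simp
  · intro S y x
    induction x using TensorProduct.induction_on with
    | zero => simp
    | tmul l z => simp [hC]
    | add x z hx hz => rw [mul_add, map_add, hx, hz, map_add, mul_add]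
  · intro S x y
    induction x using TensorProduct.induction_on with
    | zero => simp
    | tmul l z => simp [hC]
    | add x z hx hz => rw [add_mul, map_add, hx, hz, map_add, add_mul]

end existence

/-! ### Coefficients and graded parts of the generating products -/

variable {ι R A Λ B : Type*} [DecidableEq ι] [CommRing R] [Ring A] [Algebra R A]
  [CommRing Λ] [Ring B] [Algebra R Λ] [Algebra R B] [Algebra Λ B] [IsScalarTower R Λ B]
  (E : SqZeroExtension ι R A Λ B) {p : ι → ι → R} {br : ι → ι → A}

theorem isFKFamily (h : IsFKFamily p br) :
    IsFKFamily (fun i j => algebraMap R Λ (p i j)) (fun i j => E.incl (br i j)) where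
  diag := (h.map E.incl).diag
  antisymm := (h.map E.incl).antisymm
  sq i j hij := by rw [(h.map E.incl).sq i j hij, IsScalarTower.algebraMap_apply R Λ B]
  comm := (h.map E.incl).comm
  threeTerm := (h.map E.incl).threeTerm

/-- The product of generating series attached to brackets in `A`. -/
noncomputable def genProd (br : ι → ι → A) (I : Finset ι) (L : List ι) : B :=
  IsFKFamily.prodW (fun i j => E.incl (br i j)) E.t I L

/-- Only variables `tₐ` with `a ∈ I` occur. Stripping the first letter shrinks `S`, and having no
further letter with second index `b` shrinks the list, whence the double induction. -/
theorem coeff_genProd_eq_zero (br : ι → ι → A) {I : Finset ι} (L : List ι) (S : Finset ι)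
    (hS : ¬S ⊆ I) : E.coeff S (E.genProd br I L) = 0 := by
  induction hc : S.card using Nat.strong_induction_on generalizing S L with
  | _ c ih =>
  subst hc
  induction L with
  | nil =>
    rw [genProd, IsFKFamily.prodW, List.map_nil, List.prod_nil, coeff_one, if_neg]
    rintro rfl
    exact hS (Finset.empty_subset I)
  | cons b L ihL =>
    rw [genProd, IsFKFamily.prodW_cons_eq E.mul_self, map_add, map_sum]
    refine (add_eq_right.2 ihL).trans (Finset.sum_eq_zero fun a ha => ?_)
    rw [coeff_smul]
    split_ifs with haS
    · rw [coeff_incl_mul]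
      refine (congrArg _ (ih _ (Finset.card_erase_lt_of_mem haS) (b :: L) _ (fun hh => hS ?_)
        rfl)).trans (mul_zero _)
      rw [← Finset.insert_erase haS]
      exact Finset.insert_subset ha hh
    · rfl

theorem coeff_empty_genProd (br : ι → ι → A) (I : Finset ι) (L : List ι) :
    E.coeff ∅ (E.genProd br I L) = 1 := by
  induction L with
  | nil => rw [genProd, IsFKFamily.prodW, List.map_nil, List.prod_nil, coeff_one, if_pos rfl]
  | cons b L ih =>
    rw [genProd, IsFKFamily.prodW_cons_eq E.mul_self, map_add, map_sum]
    refine (add_eq_left.2 (Finset.sum_eq_zero fun a _ => ?_)).trans ih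
    rw [coeff_smul, if_neg (Finset.notMem_empty a)]

variable [Fintype ι]

/-- The sum of all coefficients of squarefree monomials of degree `k`. -/
noncomputable def grade (k : ℕ) : B →ₗ[R] A := ∑ S ∈ Finset.powersetCard k Finset.univ, E.coeff S

theorem grade_apply (k : ℕ) (x : B) :
    E.grade k x = ∑ S ∈ Finset.powersetCard k Finset.univ, E.coeff S x := by
  simp [grade]

theorem grade_zero (x : B) : E.grade 0 x = E.coeff ∅ x := by
  simp [grade_apply]

theorem grade_zero_smul (e : ι) (x : B) : E.grade 0 (E.t e • x) = 0 := by
  rw [grade_zero, coeff_smul, if_neg (Finset.notMem_empty e)]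

theorem grade_mul_incl (k : ℕ) (x : B) (y : A) : E.grade k (x * E.incl y) = E.grade k x * y := by
  simp only [grade_apply, coeff_mul_incl, Finset.sum_mul]

/-- Removing `e` matches the `(k+1)`-sets containing `e` with the `k`-sets avoiding it; the
hypothesis on `x` discards the remaining `k`-sets. -/
theorem grade_succ_smul {e : ι} {x : B} (hx : ∀ S, e ∈ S → E.coeff S x = 0) (k : ℕ) :
    E.grade (k + 1) (E.t e • x) = E.grade k x := by
  rw [grade_apply, grade_apply]
  simp only [coeff_smul]
  rw [← Finset.sum_filter]
  have : ∑ S ∈ Finset.powersetCard k Finset.univ, E.coeff S x =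
      ∑ S ∈ (Finset.powersetCard k Finset.univ).filter (e ∉ ·), E.coeff S x := by
    rw [Finset.sum_filter]
    refine Finset.sum_congr rfl fun S _ => ?_
    split_ifs with hS
    · exact hx S hS
    · rfl
  rw [this]
  refine Finset.sum_nbij' (fun S => S.erase e) (fun S => insert e S) ?_ ?_ ?_ ?_ ?_
  · intro S hS
    simp only [Finset.mem_filter, Finset.mem_powersetCard_univ] at hS ⊢
    exact ⟨by rw [Finset.card_erase_of_mem hS.2, hS.1]; rfl, Finset.notMem_erase e S⟩
  · intro S hS
    simp only [Finset.mem_filter, Finset.mem_powersetCard_univ] at hS ⊢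
    exact ⟨by rw [Finset.card_insert_of_notMem hS.2, hS.1], Finset.mem_insert_self e S⟩
  · intro S hS
    exact Finset.insert_erase (Finset.mem_filter.1 hS).2
  · intro S hS
    exact Finset.erase_insert (Finset.mem_filter.1 hS).2
  · exact fun _ _ => rfl

theorem grade_succ_smul_genProd (br : ι → ι → A) {I : Finset ι} {e : ι} (he : e ∉ I) (k : ℕ)
    (L : List ι) : E.grade (k + 1) (E.t e • E.genProd br I L) = E.grade k (E.genProd br I L) :=
  E.grade_succ_smul (fun S hS => E.coeff_genProd_eq_zero br L S fun hh => he (hh hS)) k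

/-- The effect of one more second index on the degree `k + 1` part. -/
theorem grade_genProd_append (br : ι → ι → A) (k : ℕ) (I : Finset ι) (j : ι) (L : List ι) :
    E.grade (k + 1) (E.genProd br I (L ++ [j])) = E.grade (k + 1) (E.genProd br I L) +
      ∑ i ∈ I, E.grade k (E.genProd br (I.erase i) (L ++ [j])) * br i j := by
  have := IsFKFamily.prodW_append_singleton (br := fun i j => E.incl (br i j)) E.mul_self I j L
  rw [genProd, this, map_add, map_sum]
  congr 1
  refine Finset.sum_congr rfl fun i _ => ?_
  rw [← smul_mul_assoc, grade_mul_incl]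
  exact congrArg (· * br i j) (E.grade_succ_smul_genProd br (Finset.notMem_erase i I) k (L ++ [j]))

/-- The recursion of the deformed elementary symmetric polynomials, for degree `k + 1` parts. -/
theorem grade_genProd_insert (h : IsFKFamily p br) {I : Finset ι} {j : ι}
    (hj : j ∉ I) {L : List ι} (hL : L.Nodup) (hjL : j ∉ L) (hIL : ∀ b ∈ L, b ∉ I) (k : ℕ) :
    E.grade (k + 1) (E.genProd br (insert j I) L) =
      E.grade (k + 1) (E.genProd br I (L ++ [j])) +
      E.grade k (E.genProd br I (L ++ [j])) * ((L.map fun l => br j l).sum - ∑ i ∈ I, br i j) +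
      ∑ i ∈ I, p i j • E.grade k (E.t i • E.genProd br (I.erase i) (L ++ [j, i])) := by
  have hmain : E.genProd br (insert j I) L = E.genProd br I L +
      E.t j • (E.genProd br I (L ++ [j]) * (L.map fun l => E.incl (br j l)).sum -
        ∑ i ∈ I, (E.genProd br I (L ++ [j]) - E.genProd br (I.erase i) (L ++ [j])) *
          E.incl (br i j) +
        ∑ i ∈ I, E.t i • algebraMap R Λ (p i j) • E.genProd br (I.erase i) (L ++ [j, i])) :=
    (E.isFKFamily h).prodW_insert_eq E.mul_self hj hL hjL hIL
  have hsum : (L.map fun l => E.incl (br j l)).sum = E.incl (L.map fun l => br j l).sum := by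
    rw [map_list_sum, List.map_map]; rfl
  have hjI : ∀ i, j ∉ I.erase i := fun i hh => hj (Finset.mem_of_mem_erase hh)
  -- The factor multiplied by `tⱼ` does not itself involve `tⱼ`, so its degree rises by exactly one.
  have hfree : ∀ S, j ∈ S → E.coeff S
      (E.genProd br I (L ++ [j]) * (L.map fun l => E.incl (br j l)).sum -
        ∑ i ∈ I, (E.genProd br I (L ++ [j]) - E.genProd br (I.erase i) (L ++ [j])) *
          E.incl (br i j) +
        ∑ i ∈ I, E.t i • algebraMap R Λ (p i j) • E.genProd br (I.erase i) (L ++ [j, i])) = 0 := by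
    intro S hS
    rw [map_add, map_sub, map_sum, map_sum, hsum, coeff_mul_incl,
      E.coeff_genProd_eq_zero br _ S fun hh => hj (hh hS), zero_mul, zero_sub, neg_add_eq_zero,
      Finset.sum_eq_zero, Finset.sum_eq_zero]
    · intro i hi
      rw [coeff_smul, algebraMap_smul, map_smul]
      split_ifs with hiS
      · rw [E.coeff_genProd_eq_zero br _ (S.erase i) fun hh => hjI i (hh (Finset.mem_erase.2
          ⟨(ne_of_mem_of_not_mem hi hj).symm, hS⟩)), smul_zero]
      · rfl
    · intro i _
      rw [coeff_mul_incl, map_sub, E.coeff_genProd_eq_zero br _ S fun hh => hj (hh hS),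
        E.coeff_genProd_eq_zero br _ S fun hh => hjI i (hh hS), sub_zero, zero_mul]
  rw [hmain, map_add, E.grade_succ_smul hfree, map_add, map_sub, map_sum, map_sum, hsum,
    grade_mul_incl, grade_genProd_append, mul_sub, Finset.mul_sum]
  simp only [grade_mul_incl, map_sub, sub_mul, Finset.sum_sub_distrib]
  have hp : ∀ i ∈ I, E.grade k (E.t i • algebraMap R Λ (p i j) •
      E.genProd br (I.erase i) (L ++ [j, i])) =
      p i j • E.grade k (E.t i • E.genProd br (I.erase i) (L ++ [j, i])) := by
    intro i _
    rw [smul_comm, algebraMap_smul, map_smul]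
  rw [Finset.sum_congr rfl hp]
  abel

end SqZeroExtension

-- `L` is an arbitrary enumeration of the complement, because the recursion appends `j` and then `i`
-- at its end and so leaves sorted order.
open SqZeroExtension in
theorem IsFKFamily.pElem_eq_grade {n : ℕ} {R A Λ B : Type*} [CommRing R] [Ring A] [Algebra R A]
    [CommRing Λ] [Ring B] [Algebra R Λ] [Algebra R B] [Algebra Λ B] [IsScalarTower R Λ B]
    (E : SqZeroExtension (Fin n) R A Λ B) {p : Fin n → Fin n → R} {br : Fin n → Fin n → A}
    (h : IsFKFamily p br) (I : Finset (Fin n)) : ∀ (k : ℕ) (L : List (Fin n)), L.Nodup →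
      (∀ b, b ∈ L ↔ b ∉ I) → pElem p (dunkl br) k I = E.grade k (E.genProd br I L) := by
  induction hc : I.card using Nat.strong_induction_on generalizing I with
  | _ c ih =>
  subst hc
  intro k L hL hIL
  rcases k with _ | k
  · rw [pElem_zero, grade_zero, coeff_empty_genProd]
  rcases I.eq_empty_or_nonempty with rfl | hI
  · rw [pElem_empty, grade_apply]
    refine (Finset.sum_eq_zero fun S hS => E.coeff_genProd_eq_zero br L S ?_).symm
    rw [Finset.subset_empty]
    rintro rfl
    simp at hS
  obtain ⟨j, hj⟩ : ∃ j, I.max' hI = j := ⟨_, rfl⟩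
  have hjI : j ∈ I := hj ▸ I.max'_mem hI
  have hjL : j ∉ L := fun hh => (hIL j).1 hh hjI
  rw [pElem, dif_pos hI, hj]
  set I' := I.erase j with hI'
  have hjI' : j ∉ I' := Finset.notMem_erase j I
  have hins : insert j I' = I := Finset.insert_erase hjI
  have hcard : I'.card < I.card := Finset.card_erase_lt_of_mem hjI
  have hLj : (L ++ [j]).Nodup := by
    rw [← List.concat_eq_append]; exact hL.concat hjL
  have hILj : ∀ b, b ∈ L ++ [j] ↔ b ∉ I' := by
    intro b
    rw [List.mem_append, List.mem_singleton, hIL, hI', Finset.mem_erase]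
    tauto
  have hθ : dunkl br j = (L.map fun l => br j l).sum - ∑ i ∈ I', br i j := by
    have hsplit : Finset.univ.erase j = L.toFinset ∪ I' := by
      ext b
      simp only [Finset.mem_erase, Finset.mem_univ, and_true, Finset.mem_union,
        List.mem_toFinset, hIL, hI']
      by_cases hb : b ∈ I
      · simp [hb]
      · simp [hb, (ne_of_mem_of_not_mem hjI hb).symm]
    have hdisj : Disjoint L.toFinset I' := by
      rw [Finset.disjoint_left]
      intro b hb hb'
      exact (hIL b).1 (List.mem_toFinset.1 hb) (Finset.mem_of_mem_erase hb')
    rw [dunkl, hsplit, Finset.sum_union hdisj, List.sum_toFinset _ hL, sub_eq_add_neg,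
      ← Finset.sum_neg_distrib]
    simp only [h.antisymm _ j]
  have hrec := E.grade_genProd_insert h hjI' hL hjL
    (fun b hb hh => (hIL b).1 hb (Finset.mem_of_mem_erase hh)) k
  rw [hins, ← ih _ hcard _ rfl (k + 1) _ hLj hILj, ← ih _ hcard _ rfl k _ hLj hILj, ← hθ] at hrec
  rw [hrec]
  congr 1
  -- In degree one the `p`-terms disappear, since a multiple of `tᵢ` has no constant coefficient;
  -- this matches `E_{-1} = 0`.
  rcases k with _ | k
  · simp [grade_zero_smul]
  · rw [if_neg (Nat.succ_ne_zero k)]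
    refine Finset.sum_congr rfl fun i hi => ?_
    rw [E.grade_succ_smul_genProd br (Finset.notMem_erase i I'), Nat.add_sub_cancel]
    have hij : i ≠ j := ne_of_mem_of_not_mem hi hjI'
    refine congrArg _ (ih _ (lt_of_le_of_lt Finset.card_erase_le hcard) _ rfl k _ ?_ ?_)
    · rw [show L ++ [j, i] = (L ++ [j]) ++ [i] by simp, ← List.concat_eq_append]
      exact hLj.concat fun hh => (hILj i).1 hh hi
    · clear_value I'
      intro b
      rw [show L ++ [j, i] = (L ++ [j]) ++ [i] by simp, List.mem_append, hILj,
        List.mem_singleton, Finset.mem_erase]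
      tauto

/-! ### The right-hand side of the Pieri formula -/

section pieri

variable {n : ℕ} {R A Λ B : Type*} [CommRing R] [Ring A] [Algebra R A]
  [CommRing Λ] [Ring B] [Algebra R Λ] [Algebra R B] [Algebra Λ B] [IsScalarTower R Λ B]

open Classical in
/-- `pieriSum` with second indices restricted to a list. -/
noncomputable def pieriList (br : Fin n → Fin n → A) (k : ℕ) (I : Finset (Fin n))
    (L : List (Fin n)) : A :=
  ∑ ab : (Fin k → Fin n) × (Fin k → Fin n) with
      (∀ s, ab.1 s ∈ I) ∧ (∀ s, ab.2 s ∈ L) ∧ Function.Injective ab.1 ∧ Monotone ab.2,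
    (List.ofFn fun s => br (ab.1 s) (ab.2 s)).prod

theorem pieriSum_eq_pieriList (br : Fin n → Fin n → A) (k : ℕ) {I : Finset (Fin n)}
    {L : List (Fin n)} (hL : ∀ b, b ∈ L ↔ b ∉ I) : pieriSum br k I = pieriList br k I L := by
  simp only [pieriSum, pieriList, hL]

theorem pieriList_zero (br : Fin n → Fin n → A) (I : Finset (Fin n)) (L : List (Fin n)) :
    pieriList br 0 I L = 1 := by
  rw [pieriList, Finset.filter_true_of_mem]
  · simp
  · rintro ab -
    exact ⟨fun s => s.elim0, fun s => s.elim0, fun s => s.elim0, fun s => s.elim0⟩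

theorem pieriList_succ_nil (br : Fin n → Fin n → A) (k : ℕ) (I : Finset (Fin n)) :
    pieriList br (k + 1) I [] = 0 := by
  rw [pieriList, Finset.filter_false_of_mem, Finset.sum_empty]
  rintro ab - ⟨-, h, -⟩
  exact List.not_mem_nil (h 0)

theorem monotone_fin_cons {k : ℕ} {β : Fin n} {b : Fin k → Fin n} :
    Monotone (Fin.cons β b : Fin (k + 1) → Fin n) ↔ (∀ s, β ≤ b s) ∧ Monotone b := by
  constructor
  · intro h
    refine ⟨fun s => ?_, fun s s' hs => ?_⟩
    · simpa using h (Fin.zero_le s.succ)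
    · simpa using h (Fin.succ_le_succ_iff.2 hs)
  · rintro ⟨h1, h2⟩ s s' hs
    induction s using Fin.cases with
    | zero =>
      induction s' using Fin.cases with
      | zero => exact le_rfl
      | succ s' => simpa using h1 s'
    | succ s =>
      induction s' using Fin.cases with
      | zero => exact absurd hs (by simp)
      | succ s' => simpa using h2 (Fin.succ_le_succ_iff.1 hs)

/-- Split by whether `b₁ = β`. If not, monotonicity excludes `β` altogether. If so, strip the first
bracket: `a₁` is used up, but `β` may occur again, so the list stays `β :: L`. -/
theorem pieriList_succ_cons (br : Fin n → Fin n → A) (k : ℕ) (I : Finset (Fin n)) {β : Fin n}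
    {L : List (Fin n)} (hL : ∀ b ∈ L, β < b) :
    pieriList br (k + 1) I (β :: L) =
      pieriList br (k + 1) I L + ∑ a ∈ I, br a β * pieriList br k (I.erase a) (β :: L) := by
  classical
  have hle : ∀ b ∈ β :: L, β ≤ b := by
    intro b hb
    rcases List.mem_cons.1 hb with rfl | hb
    exacts [le_rfl, (hL b hb).le]
  rw [pieriList, ← Finset.sum_filter_not_add_sum_filter _
    (fun ab : (Fin (k + 1) → Fin n) × (Fin (k + 1) → Fin n) => ab.2 0 = β), Finset.filter_filter,
    Finset.filter_filter, pieriList]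
  congr 1
  · refine Finset.sum_congr (Finset.filter_congr ?_) fun _ _ => rfl
    rintro ⟨a, b⟩ -
    constructor
    · rintro ⟨⟨h1, h2, h3, h4⟩, h0⟩
      refine ⟨h1, fun s => ?_, h3, h4⟩
      have hb0 : b 0 ∈ L := (List.mem_cons.1 (h2 0)).resolve_left h0
      exact (List.mem_cons.1 (h2 s)).resolve_left
        ((hL _ hb0).trans_le (h4 (Fin.zero_le s))).ne'
    · rintro ⟨h1, h2, h3, h4⟩
      exact ⟨⟨h1, fun s => List.mem_cons_of_mem _ (h2 s), h3, h4⟩, (hL _ (h2 0)).ne'⟩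
  · simp only [pieriList, Finset.mul_sum]
    rw [Finset.sum_sigma']
    refine Finset.sum_bij' (fun ab _ => ⟨ab.1 0, (Fin.tail ab.1, Fin.tail ab.2)⟩)
      (fun x _ => (Fin.cons x.1 x.2.1, Fin.cons β x.2.2)) ?_ ?_ ?_ ?_ ?_
    · rintro ⟨a, b⟩ h
      simp only [Finset.mem_filter, Finset.mem_univ, true_and, Finset.mem_sigma,
        Finset.mem_erase] at h ⊢
      obtain ⟨⟨h1, h2, h3, h4⟩, h0⟩ := h
      refine ⟨h1 0, fun s => ⟨fun hs => ?_, h1 _⟩, fun s => h2 _, ?_, ?_⟩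
      · exact Fin.succ_ne_zero s (h3 hs)
      · exact h3.comp (Fin.succ_injective k)
      · exact h4.comp (Fin.strictMono_succ).monotone
    · rintro ⟨a0, a, b⟩ h
      simp only [Finset.mem_filter, Finset.mem_univ, true_and, Finset.mem_sigma,
        Finset.mem_erase] at h ⊢
      obtain ⟨h0, h1, h2, h3, h4⟩ := h
      refine ⟨⟨fun s => ?_, fun s => ?_, ?_, ?_⟩, rfl⟩
      · induction s using Fin.cases with
        | zero => exact h0
        | succ s => exact (h1 s).2
      · induction s using Fin.cases with
        | zero => exact List.mem_cons_self
        | succ s => exact h2 s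
      · rw [Fin.cons_injective_iff]
        exact ⟨fun ⟨s, hs⟩ => (h1 s).1 hs, h3⟩
      · exact monotone_fin_cons.2 ⟨fun s => hle _ (h2 s), h4⟩
    · rintro ⟨a, b⟩ h
      have h0 : b 0 = β := (Finset.mem_filter.1 h).2.2
      simp only [Prod.mk.injEq]
      exact ⟨Fin.cons_self_tail a, by rw [← h0]; exact Fin.cons_self_tail b⟩
    · rintro ⟨a0, a, b⟩ h
      simp
    · rintro ⟨a, b⟩ h
      have h0 : b 0 = β := (Finset.mem_filter.1 h).2.2
      rw [List.ofFn_succ, List.prod_cons]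
      simp only [h0]
      rfl

/-- Both sides satisfy the recursion of `pieriList_succ_cons`. The product keeps a fixed `J` while
`I` shrinks, since the remaining series after stripping a letter is unchanged. -/
theorem SqZeroExtension.sum_coeff_genProd (E : SqZeroExtension (Fin n) R A Λ B)
    (br : Fin n → Fin n → A) {J : Finset (Fin n)} {L : List (Fin n)} (hL : L.Pairwise (· < ·))
    (k : ℕ) : ∀ I ⊆ J, ∑ S ∈ Finset.powersetCard k I, E.coeff S (E.genProd br J L) =
      pieriList br k I L := by
  induction k generalizing L with
  | zero =>
    intro I _
    rw [Finset.powersetCard_zero, Finset.sum_singleton, coeff_empty_genProd, pieriList_zero]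
  | succ k ihk =>
  induction L with
  | nil =>
    intro I _
    rw [pieriList_succ_nil]
    refine Finset.sum_eq_zero fun S hS => ?_
    rw [genProd, IsFKFamily.prodW, List.map_nil, List.prod_nil, coeff_one, if_neg]
    rintro rfl
    simp at hS
  | cons β L ih =>
    intro I hI
    rw [List.pairwise_cons] at hL
    have hstep : ∀ S ∈ Finset.powersetCard (k + 1) I, E.coeff S (E.genProd br J (β :: L)) =
        E.coeff S (E.genProd br J L) + ∑ a ∈ I, br a β *
          if a ∈ S then E.coeff (S.erase a) (E.genProd br J (β :: L)) else 0 := by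
      intro S hS
      have hSI := (Finset.mem_powersetCard.1 hS).1
      conv_lhs => rw [genProd, IsFKFamily.prodW_cons_eq E.mul_self, map_add, map_sum]
      refine congrArg₂ (· + ·) rfl ?_
      rw [← Finset.sum_subset hI]
      · refine Finset.sum_congr rfl fun a _ => ?_
        rw [coeff_smul, coeff_incl_mul, mul_ite, mul_zero]
        rfl
      · intro a _ haI
        rw [coeff_smul, if_neg fun h => haI (hSI h)]
    rw [Finset.sum_congr rfl hstep, Finset.sum_add_distrib, pieriList_succ_cons br k I hL.1,
      ih hL.2 I hI, Finset.sum_comm]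
    congr 1
    refine Finset.sum_congr rfl fun a ha => ?_
    rw [← Finset.mul_sum, ← ihk (List.pairwise_cons.2 hL) _ ((Finset.erase_subset a I).trans hI),
      ← Finset.sum_filter]
    congr 1
    refine Finset.sum_nbij' (fun S => S.erase a) (fun S => insert a S) ?_ ?_ ?_ ?_ ?_
    · intro S hS
      simp only [Finset.mem_filter, Finset.mem_powersetCard] at hS ⊢
      exact ⟨Finset.erase_subset_erase a hS.1.1, by
        rw [Finset.card_erase_of_mem hS.2, hS.1.2]; rfl⟩
    · intro S hS
      simp only [Finset.mem_filter, Finset.mem_powersetCard] at hS ⊢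
      refine ⟨⟨Finset.insert_subset ha (hS.1.trans (Finset.erase_subset a I)), ?_⟩,
        Finset.mem_insert_self a S⟩
      rw [Finset.card_insert_of_notMem fun h => Finset.notMem_erase a I (hS.1 h), hS.2]
    · intro S hS
      exact Finset.insert_erase (Finset.mem_filter.1 hS).2
    · intro S hS
      exact Finset.erase_insert fun h =>
        Finset.notMem_erase a I ((Finset.mem_powersetCard.1 hS).1 h)
    · exact fun _ _ => rfl

end pieri

/-! ### The Pieri formula for bracket families -/

/-- The Pieri formula for the Dunkl elements of any family of brackets. -/
theorem IsFKFamily.pElem_eq_pieriSum {n : ℕ} {R A : Type*} [CommRing R] [Ring A] [Algebra R A]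
    {p : Fin n → Fin n → R} {br : Fin n → Fin n → A} (h : IsFKFamily p br)
    (I : Finset (Fin n)) (k : ℕ) : pElem p (dunkl br) k I = pieriSum br k I := by
  obtain ⟨Λ, B, _, _, _, _, _, _, ⟨E⟩⟩ := SqZeroExtension.exists_extension (ι := Fin n) R A
  have hL : ∀ b, b ∈ (Iᶜ).sort (· ≤ ·) ↔ b ∉ I := by simp
  rw [h.pElem_eq_grade E I k _ (Finset.sort_nodup _ _) hL, pieriSum_eq_pieriList br k hL,
    ← E.sum_coeff_genProd br (Finset.sortedLT_sort _).pairwise k I Finset.Subset.rfl, E.grade_apply]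
  -- `grade` sums over all `k`-subsets, but those not contained in `I` have zero coefficient.
  refine (Finset.sum_subset (Finset.powersetCard_mono (Finset.subset_univ I)) ?_).symm
  intro S hS hS'
  refine E.coeff_genProd_eq_zero br _ S fun hSI => hS' ?_
  rw [Finset.mem_powersetCard] at hS ⊢
  exact ⟨hSI, hS.2⟩

theorem isFKFamily_br {n : ℕ} {R : Type*} [CommRing R] (p : Fin n → Fin n → R) :
    IsFKFamily p (FKAlg.br p) where
  diag i := (RingQuot.mkAlgHom_rel R (FKRel.diag i)).trans (map_zero _)
  antisymm i j := (RingQuot.mkAlgHom_rel R (FKRel.antisymm i j)).trans (map_neg _ _)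
  sq i j hij := by
    have := RingQuot.mkAlgHom_rel R (FKRel.sq (p := p) i j hij)
    rwa [map_pow, AlgHom.commutes, pow_two] at this
  comm i j k l h1 h2 h3 h4 h5 h6 := by
    have := RingQuot.mkAlgHom_rel R (FKRel.comm (p := p) i j k l h1 h2 h3 h4 h5 h6)
    rwa [map_mul, map_mul] at this
  threeTerm i j k h1 h2 h3 := by
    have := RingQuot.mkAlgHom_rel R (FKRel.threeTerm (p := p) i j k h1 h2 h3)
    rwa [map_add, map_add, map_mul, map_mul, map_mul, map_zero] at this

/-! ### Meromorphic functions -/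

section mero

variable {n : ℕ}

theorem meroFun_mk_eq {f g : meroFun n} {D : Set (Fin n → ℂ)} (hD : IsOpen D) (hD' : Dense D)
    (h : ∀ y ∈ D, f.1 y = g.1 y) :
    Ideal.Quotient.mk (meroNull n) f = Ideal.Quotient.mk (meroNull n) g := by
  rw [Ideal.Quotient.eq]
  exact ⟨D, hD, hD', fun y hy => sub_eq_zero.2 (h y hy)⟩

theorem meroFun_mk_eq_of_forall {f g : meroFun n} (h : ∀ y, f.1 y = g.1 y) :
    Ideal.Quotient.mk (meroNull n) f = Ideal.Quotient.mk (meroNull n) g :=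
  congrArg _ (Subtype.ext (funext h))

instance nontrivial_mero : Nontrivial (Mero n) := by
  refine Ideal.Quotient.nontrivial_iff.2 ((Ideal.ne_top_iff_one _).2 ?_)
  rintro ⟨D, -, hD, h⟩
  obtain ⟨y, hy⟩ := hD.nonempty
  exact one_ne_zero (h y hy)

theorem meroPerm_mul (σ τ : Equiv.Perm (Fin n)) (f : Mero n) :
    meroPerm σ (meroPerm τ f) = meroPerm (σ * τ) f := by
  obtain ⟨f, rfl⟩ := Ideal.Quotient.mk_surjective f
  rfl

theorem meroPerm_one (f : Mero n) : meroPerm 1 f = f := by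
  obtain ⟨f, rfl⟩ := Ideal.Quotient.mk_surjective f
  rfl

theorem meroPerm_diff (σ : Equiv.Perm (Fin n)) (f : Mero₁) (i j : Fin n) :
    meroPerm σ (f.diff i j) = f.diff (σ i) (σ j) := rfl

theorem simplePole_diff_self (a : ℂ) (i : Fin n) : (simplePole a).diff i i = 0 := by
  rw [← map_zero (Ideal.Quotient.mk (meroNull n))]
  exact meroFun_mk_eq_of_forall fun y => by
    change a / (y i - y i) = 0
    simp

theorem simplePole_diff_swap (a : ℂ) (i j : Fin n) :
    (simplePole a).diff j i = -(simplePole a).diff i j := by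
  rw [Mero₁.diff, Mero₁.diff, ← map_neg]
  exact meroFun_mk_eq_of_forall fun y => by
    change a / (y j - y i) = -(a / (y i - y j))
    rw [← div_neg, neg_sub]

theorem constPsi_diff (a : ℂ) (p : Fin n → Fin n → ℂ) (i j : Fin n) :
    (constPsi (a ^ 2) p i j).diff i j =
      (simplePole a).diff i j * (simplePole a).diff i j + algebraMap ℂ (Mero n) (p i j) := by
  rw [Mero₁.diff, Mero₁.diff, ← map_mul, ← Ideal.Quotient.mk_algebraMap, ← map_add]
  exact meroFun_mk_eq_of_forall fun y => by
    change a ^ 2 / (y i - y j) ^ 2 + p i j = a / (y i - y j) * (a / (y i - y j)) + p i j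
    rw [div_mul_div_comm, pow_two, pow_two]

/-- A partial fraction identity, valid on the dense open set where the three differences are
nonzero; with the convention `a / 0 = 0` it may fail elsewhere. -/
theorem simplePole_diff_threeTerm (a : ℂ) {i j k : Fin n} (hij : i ≠ j) (hjk : j ≠ k)
    (hki : k ≠ i) :
    (simplePole a).diff i j * (simplePole a).diff j k +
      (simplePole a).diff j k * (simplePole a).diff k i +
      (simplePole a).diff k i * (simplePole a).diff i j = 0 := by
  have hopen : ∀ i j : Fin n, IsOpen {y : Fin n → ℂ | y i - y j ≠ 0} := fun i j =>
    isOpen_ne.preimage ((continuous_apply i).sub (continuous_apply j))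
  have hdense : ∀ i j : Fin n, i ≠ j → Dense {y : Fin n → ℂ | y i - y j ≠ 0} := fun i j h =>
    (dense_compl_singleton (0 : ℂ)).preimage (isOpenMap_coord_sub h)
  simp only [Mero₁.diff, ← map_mul, ← map_add]
  rw [← map_zero (Ideal.Quotient.mk (meroNull n))]
  refine meroFun_mk_eq (((hopen i j).inter (hopen j k)).inter (hopen k i))
    (((hdense i j hij).inter_of_isOpen_left (hdense j k hjk) (hopen i j)).inter_of_isOpen_left
      (hdense k i hki) ((hopen i j).inter (hopen j k))) ?_
  rintro y ⟨⟨h1, h2⟩, h3⟩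
  simp only [Set.mem_ofPred_eq] at h1 h2 h3
  change a / (y i - y j) * (a / (y j - y k)) + a / (y j - y k) * (a / (y k - y i)) +
    a / (y k - y i) * (a / (y i - y j)) = 0
  field_simp
  ring

end mero

/-! ### Shifting brackets by simple poles -/

section shift

variable {n : ℕ} {A : Type*} [Ring A] [Algebra ℂ A] (a : ℂ) (F : Mero n →ₐ[ℂ] A)
  {br : Fin n → Fin n → A}
  (tw : ∀ i j, i ≠ j → ∀ f, br i j * F f = F (meroPerm (Equiv.swap i j) f) * br i j)

/-- The element `⟨ij⟩ = [ij] + a / (xᵢ - xⱼ)`. -/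
noncomputable def shift (br : Fin n → Fin n → A) (i j : Fin n) : A :=
  br i j + F ((simplePole a).diff i j)

include tw

/-- `s_{ij}` changes the sign of `a / (xᵢ - xⱼ)`, so the two cross terms cancel. -/
theorem shift_sq {i j : Fin n} (hij : i ≠ j) :
    shift a F br i j ^ 2 = br i j * br i j +
      F ((simplePole a).diff i j * (simplePole a).diff i j) := by
  have h := tw i j hij ((simplePole a).diff i j)
  rw [meroPerm_diff, Equiv.swap_apply_left, Equiv.swap_apply_right, simplePole_diff_swap a i j,
    map_neg] at h
  rw [pow_two, shift, add_mul, mul_add, mul_add, h, map_mul]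
  noncomm_ring

theorem shift_comm {i j k l : Fin n} (hij : i ≠ j) (hkl : k ≠ l)
    (hik : i ≠ k) (hil : i ≠ l) (hjk : j ≠ k) (hjl : j ≠ l) :
    shift a F br i j * shift a F br k l - shift a F br k l * shift a F br i j =
      br i j * br k l - br k l * br i j := by
  have h1 := tw i j hij ((simplePole a).diff k l)
  have h2 := tw k l hkl ((simplePole a).diff i j)
  rw [meroPerm_diff, Equiv.swap_apply_of_ne_of_ne hik.symm hjk.symm,
    Equiv.swap_apply_of_ne_of_ne hil.symm hjl.symm] at h1
  rw [meroPerm_diff, Equiv.swap_apply_of_ne_of_ne hik hil,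
    Equiv.swap_apply_of_ne_of_ne hjk hjl] at h2
  simp only [shift, add_mul, mul_add, h1, h2]
  rw [← map_mul, ← map_mul, mul_comm ((simplePole a).diff i j)]
  abel

/-- The cross terms cancel in the cyclic sum, and the purely functional terms add up to zero by
`simplePole_diff_threeTerm`. -/
theorem shift_threeTerm {i j k : Fin n} (hij : i ≠ j) (hjk : j ≠ k) (hki : k ≠ i) :
    shift a F br i j * shift a F br j k + shift a F br j k * shift a F br k i +
      shift a F br k i * shift a F br i j =
      br i j * br j k + br j k * br k i + br k i * br i j := by
  have h : ∀ i j k : Fin n, i ≠ j → j ≠ k → k ≠ i → shift a F br i j * shift a F br j k =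
      br i j * br j k - F ((simplePole a).diff k i) * br i j +
        F ((simplePole a).diff i j) * br j k +
        F ((simplePole a).diff i j * (simplePole a).diff j k) := by
    intro i j k hij hjk hki
    have h1 := tw i j hij ((simplePole a).diff j k)
    rw [meroPerm_diff, Equiv.swap_apply_right, Equiv.swap_apply_of_ne_of_ne hki hjk.symm,
      simplePole_diff_swap a k i, map_neg] at h1
    rw [shift, shift, add_mul, mul_add, mul_add, h1, map_mul]
    noncomm_ring
  have h0 := congrArg F (simplePole_diff_threeTerm a hij hjk hki)
  rw [map_add, map_add, map_zero] at h0
  rw [h i j k hij hjk hki, h j k i hjk hki hij, h k i j hki hij hjk, ← sub_eq_zero, ← h0]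
  abel

end shift

/-! ### The limit algebra -/

section limit

variable {n : ℕ} (a : ℂ) (p : Fin n → Fin n → ℂ)

/-- Meromorphic functions as elements of `Ẽₙ(φᵢⱼ, ψᵢⱼ)`. -/
noncomputable def EllAlg.ofMero (φ ψ : Fin n → Fin n → Mero₁) : Mero n →ₐ[ℂ] EllAlg φ ψ :=
  AlgHom.ofLinearMap
    { toFun := fun f => RingQuot.mkAlgHom ℂ (EllRel φ ψ) (genFun f)
      map_add' := fun f g => by
        rw [RingQuot.mkAlgHom_rel ℂ (EllRel.fun_add f g), map_add]
      map_smul' := fun c f => by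
        rw [Algebra.smul_def, RingQuot.mkAlgHom_rel ℂ (EllRel.fun_mul _ f), map_mul,
          RingQuot.mkAlgHom_rel ℂ (EllRel.fun_const c), AlgHom.commutes, RingHom.id_apply,
          Algebra.smul_def] }
    (by
      have := RingQuot.mkAlgHom_rel ℂ (EllRel.fun_const (φ := φ) (ψ := ψ) 1)
      rwa [map_one, map_one, map_one] at this)
    (fun f g => by
      change RingQuot.mkAlgHom ℂ (EllRel φ ψ) (genFun (f * g)) = _
      rw [RingQuot.mkAlgHom_rel ℂ (EllRel.fun_mul f g), map_mul]
      rfl)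

theorem TildeE.shift_br (ψ : Fin n → Fin n → Mero₁) (i j : Fin n) :
    shift a (EllAlg.ofMero (fun _ _ => simplePole a) ψ) (TildeE.br a ψ) i j =
      RingQuot.mkAlgHom ℂ (EllRel (fun _ _ => simplePole a) ψ) (genBr i j) := by
  rw [shift, TildeE.br, EllAlg.br, map_sub]
  exact sub_add_cancel _ _

theorem TildeE.br_mul (ψ : Fin n → Fin n → Mero₁) (i j : Fin n) (hij : i ≠ j) (f : Mero n) :
    TildeE.br a ψ i j * EllAlg.ofMero (fun _ _ => simplePole a) ψ f =
      EllAlg.ofMero (fun _ _ => simplePole a) ψ (meroPerm (Equiv.swap i j) f) *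
        TildeE.br a ψ i j := by
  have := RingQuot.mkAlgHom_rel ℂ (EllRel.twist (φ := fun _ _ => simplePole a) (ψ := ψ) i j hij f)
  rwa [map_mul, map_mul] at this

theorem TildeE.isFKFamily :
    IsFKFamily p (TildeE.br a (constPsi (a ^ 2) p)) where
  diag i := by
    rw [TildeE.br, EllAlg.br, simplePole_diff_self, map_sub,
      RingQuot.mkAlgHom_rel ℂ (EllRel.diag i), map_zero, zero_sub, neg_eq_zero]
    exact map_zero (EllAlg.ofMero (fun _ _ => simplePole a) (constPsi (a ^ 2) p))
  antisymm i j := by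
    rw [TildeE.br, TildeE.br, EllAlg.br, EllAlg.br, simplePole_diff_swap, map_sub, map_sub,
      RingQuot.mkAlgHom_rel ℂ (EllRel.antisymm i j), map_neg, neg_sub', sub_right_inj]
    exact map_neg (EllAlg.ofMero (fun _ _ => simplePole a) (constPsi (a ^ 2) p)) _
  sq i j hij := by
    have h := RingQuot.mkAlgHom_rel ℂ (EllRel.sq (φ := fun _ _ => simplePole a)
      (ψ := constPsi (a ^ 2) p) i j hij)
    rw [map_pow, ← TildeE.shift_br, shift_sq a _ (TildeE.br_mul a _) hij, constPsi_diff] at h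
    have h' : _ = EllAlg.ofMero (fun _ _ => simplePole a) (constPsi (a ^ 2) p) _ := h
    rw [map_add, AlgHom.commutes, add_comm] at h'
    exact add_left_cancel h'
  comm i j k l h1 h2 h3 h4 h5 h6 := by
    have h := RingQuot.mkAlgHom_rel ℂ (EllRel.comm (φ := fun _ _ => simplePole a)
      (ψ := constPsi (a ^ 2) p) i j k l h1 h2 h3 h4 h5 h6)
    rw [map_mul, map_mul, ← TildeE.shift_br, ← TildeE.shift_br, ← sub_eq_zero,
      shift_comm a _ (TildeE.br_mul a _) h1 h2 h3 h4 h5 h6, sub_eq_zero] at h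
    exact h
  threeTerm i j k h1 h2 h3 := by
    have h := RingQuot.mkAlgHom_rel ℂ (EllRel.threeTerm (φ := fun _ _ => simplePole a)
      (ψ := constPsi (a ^ 2) p) i j k h1 h2 h3)
    rw [map_add, map_add, map_mul, map_mul, map_mul, ← TildeE.shift_br, ← TildeE.shift_br,
      ← TildeE.shift_br, shift_threeTerm a _ (TildeE.br_mul a _) h1 h2 h3, map_zero] at h
    exact h

/-- Homomorphisms out of the limit algebra. -/
theorem TildeE.exists_lift {A : Type*} [Ring A] [Algebra ℂ A] (F : Mero n →ₐ[ℂ] A)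
    {br : Fin n → Fin n → A} (h : IsFKFamily p br)
    (tw : ∀ i j, i ≠ j → ∀ f, br i j * F f = F (meroPerm (Equiv.swap i j) f) * br i j) :
    ∃ Φ : TildeE a (constPsi (a ^ 2) p) →ₐ[ℂ] A,
      ∀ i j, Φ (TildeE.br a (constPsi (a ^ 2) p) i j) = br i j := by
  let G : FreeAlgebra ℂ (EllGen n) →ₐ[ℂ] A :=
    FreeAlgebra.lift ℂ (Sum.elim (fun x => shift a F br x.1 x.2) F)
  have hbr : ∀ i j, G (genBr i j) = shift a F br i j := fun i j => by simp [G, genBr]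
  have hfun : ∀ f, G (genFun f) = F f := fun f => by simp [G, genFun]
  refine ⟨RingQuot.liftAlgHom ℂ ⟨G, ?_⟩, fun i j => ?_⟩
  · intro x y hxy
    induction hxy with
    | fun_add f g => simp only [hfun, map_add]
    | fun_mul f g => simp only [hfun, map_mul]
    | fun_const c => simp only [hfun, AlgHom.commutes]
    | diag i => rw [hbr, shift, h.diag, simplePole_diff_self, map_zero, map_zero, add_zero]
    | antisymm i j =>
      rw [map_neg, hbr, hbr, shift, shift, h.antisymm i j, simplePole_diff_swap, map_neg, neg_add]
    | sq i j hij =>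
      rw [map_pow, hbr, hfun, shift_sq a F tw hij, h.sq i j hij, constPsi_diff, map_add,
        AlgHom.commutes, add_comm]
    | comm i j k l h1 h2 h3 h4 h5 h6 =>
      rw [map_mul, map_mul, hbr, hbr, ← sub_eq_zero, shift_comm a F tw h1 h2 h3 h4 h5 h6,
        sub_eq_zero]
      exact (h.comm i j k l h1 h2 h3 h4 h5 h6).eq
    | threeTerm i j k h1 h2 h3 =>
      simp only [map_add, map_mul, hbr, map_zero]
      rw [shift_threeTerm a F tw h1 h2 h3, h.threeTerm i j k h1 h2 h3]
    | twist i j hij f =>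
      simp only [map_mul, map_sub, hbr, hfun, shift, add_sub_cancel_right]
      exact tw i j hij f
  · rw [TildeE.br, EllAlg.br]
    erw [RingQuot.liftAlgHom_mkAlgHom_apply]
    rw [map_sub, hbr, hfun, shift, add_sub_cancel_right]

/-- The homomorphism from `𝓔ₙᵖ` defined by a family of brackets. -/
noncomputable def IsFKFamily.lift {R A : Type*} [CommRing R] [Ring A] [Algebra R A]
    {p : Fin n → Fin n → R} {br : Fin n → Fin n → A} (h : IsFKFamily p br) : FKAlg p →ₐ[R] A :=
  RingQuot.liftAlgHom R ⟨FreeAlgebra.lift R fun x => br x.1 x.2, by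
    intro x y hxy
    induction hxy with
    | diag i => simpa using h.diag i
    | antisymm i j => simpa using h.antisymm i j
    | sq i j hij => simpa [pow_two] using h.sq i j hij
    | comm i j k l h1 h2 h3 h4 h5 h6 => simpa using (h.comm i j k l h1 h2 h3 h4 h5 h6).eq
    | threeTerm i j k h1 h2 h3 => simpa using h.threeTerm i j k h1 h2 h3⟩

theorem IsFKFamily.lift_br {R A : Type*} [CommRing R] [Ring A] [Algebra R A]
    {p : Fin n → Fin n → R} {br : Fin n → Fin n → A} (h : IsFKFamily p br) (i j : Fin n) :
    h.lift (FKAlg.br p i j) = br i j := by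
  rw [IsFKFamily.lift, FKAlg.br, RingQuot.liftAlgHom_mkAlgHom_apply, FreeAlgebra.lift_ι_apply]

theorem FKAlg.adjoin_br {R : Type*} [CommRing R] (p : Fin n → Fin n → R) :
    Algebra.adjoin R {x | ∃ i j, i ≠ j ∧ x = FKAlg.br p i j} = ⊤ := by
  rw [eq_top_iff]
  rintro x -
  obtain ⟨w, rfl⟩ := RingQuot.mkAlgHom_surjective R (FKRel p) x
  induction w using FreeAlgebra.induction with
  | grade0 r => rw [AlgHom.commutes]; exact Subalgebra.algebraMap_mem _ r
  | grade1 x =>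
    rcases eq_or_ne x.1 x.2 with hx | hx
    · have : FKAlg.br p x.1 x.2 = 0 := hx ▸ (isFKFamily_br p).diag x.1
      rw [FKAlg.br] at this
      rw [this]
      exact Subalgebra.zero_mem _
    · exact Algebra.subset_adjoin ⟨x.1, x.2, hx, rfl⟩
  | mul x y hx hy => rw [map_mul]; exact Subalgebra.mul_mem _ hx hy
  | add x y hx hy => rw [map_add]; exact Subalgebra.add_mem _ hx hy

end limit

section limit

open TensorProduct

/-! ### Faithfulness through a twisted tensor product -/

section twisted

universe v w

variable {ι K X : Type*} {M : Type v} {A : Type w} [DecidableEq ι] [Field K] [CommRing M]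
  [Algebra K M] [Ring A]
  [Algebra K A] [Ring X] [Algebra K X] {p : ι → ι → K} {br : ι → ι → A}
  (s : Equiv.Perm ι → M →ₐ[K] M)

/-- The operator `s_{ij} ⊗ [ij]` on `M ⊗ A`. -/
noncomputable def twistedBr (br : ι → ι → A) (i j : ι) :
    Module.End K (M ⊗[K] A) :=
  TensorProduct.map (s (Equiv.swap i j)).toLinearMap (LinearMap.mulLeft K (br i j))

theorem twistedBr_tmul (i j : ι) (f : M) (y : A) :
    twistedBr s br i j (f ⊗ₜ y) = s (Equiv.swap i j) f ⊗ₜ (br i j * y) := rfl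

theorem twistedBr_mul_tmul (hs : ∀ σ τ f, s σ (s τ f) = s (σ * τ) f) (i j k l : ι) (f : M)
    (y : A) : (twistedBr s br i j * twistedBr s br k l) (f ⊗ₜ y) =
      s (Equiv.swap i j * Equiv.swap k l) f ⊗ₜ (br i j * br k l * y) := by
  rw [Module.End.mul_apply, twistedBr_tmul, twistedBr_tmul, hs, mul_assoc]

/-- The three products in the three-term relation involve the same 3-cycle, so the permutation part
factors out of `s ⊗ [ ]`. -/
theorem swap_mul_swap_rotate {i j k : ι} (hij : i ≠ j) (hki : k ≠ i) :
    Equiv.swap i j * Equiv.swap j k = Equiv.swap j k * Equiv.swap k i := by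
  rw [Equiv.mul_swap_eq_swap_mul (Equiv.swap j k) k i, Equiv.swap_apply_right,
    Equiv.swap_apply_of_ne_of_ne hij hki.symm, Equiv.swap_comm i j]

theorem IsFKFamily.twistedBr (h : IsFKFamily p br) (hs : ∀ σ τ f, s σ (s τ f) = s (σ * τ) f)
    (hs1 : ∀ f, s 1 f = f) : IsFKFamily p (twistedBr s br) where
  diag i := by
    refine TensorProduct.ext' fun f y => ?_
    rw [twistedBr_tmul, h.diag, zero_mul, tmul_zero, LinearMap.zero_apply]
  antisymm i j := by
    refine TensorProduct.ext' fun f y => ?_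
    rw [LinearMap.neg_apply, twistedBr_tmul, twistedBr_tmul, h.antisymm i j, neg_mul, tmul_neg,
      Equiv.swap_comm]
  sq i j hij := by
    refine TensorProduct.ext' fun f y => ?_
    rw [twistedBr_mul_tmul s hs, h.sq i j hij, Equiv.swap_mul_self, hs1,
      ← Algebra.smul_def, tmul_smul]
    rfl
  comm i j k l h1 h2 h3 h4 h5 h6 := by
    refine TensorProduct.ext' fun f y => ?_
    rw [twistedBr_mul_tmul s hs, twistedBr_mul_tmul s hs, (h.comm i j k l h1 h2 h3 h4 h5 h6).eq]
    rw [Equiv.mul_swap_eq_swap_mul (Equiv.swap i j) k l,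
      Equiv.swap_apply_of_ne_of_ne h3.symm h5.symm, Equiv.swap_apply_of_ne_of_ne h4.symm h6.symm]
  threeTerm i j k h1 h2 h3 := by
    refine TensorProduct.ext' fun f y => ?_
    rw [LinearMap.add_apply, LinearMap.add_apply, twistedBr_mul_tmul s hs, twistedBr_mul_tmul s hs,
      twistedBr_mul_tmul s hs, ← swap_mul_swap_rotate h2 h1, ← swap_mul_swap_rotate h1 h3,
      ← tmul_add, ← tmul_add, ← add_mul, ← add_mul, h.threeTerm i j k h1 h2 h3,
      zero_mul, tmul_zero, LinearMap.zero_apply]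

/-- Multiplication by elements of `M` on `M ⊗ A`. -/
noncomputable def mulLeftTensor (K M A : Type*) [Field K] [CommRing M]
    [Algebra K M] [Ring A] [Algebra K A] :
    M →ₐ[K] Module.End K (M ⊗[K] A) :=
  (Module.End.rTensorAlgHom K M A).comp (Algebra.lmul K M)

theorem mulLeftTensor_tmul (f g : M) (y : A) :
    mulLeftTensor K M A f (g ⊗ₜ y) = (f * g) ⊗ₜ y := rfl

theorem twistedBr_mul_mulLeftTensor (i j : ι) (f : M) :
    twistedBr s br i j * mulLeftTensor K M A f =
      mulLeftTensor K M A (s (Equiv.swap i j) f) * twistedBr s br i j := by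
  refine TensorProduct.ext' fun g y => ?_
  rw [Module.End.mul_apply, Module.End.mul_apply, mulLeftTensor_tmul, twistedBr_tmul,
    twistedBr_tmul, mulLeftTensor_tmul, map_mul]

/-- Permutations fix the constant `1`, so `L x` acts on `1 ⊗ y` as left multiplication by `x`.
Evaluating at `1 ⊗ 1` recovers `x`. -/
theorem injective_of_twistedBr [Nontrivial M]
    (hbr : Algebra.adjoin K {x | ∃ i j, i ≠ j ∧ x = br i j} = ⊤)
    (L : A →ₐ[K] X) (Φ : X →ₐ[K] Module.End K (M ⊗[K] A))
    (hΦ : ∀ i j, Φ (L (br i j)) = twistedBr s br i j) : Function.Injective L := by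
  have key : ∀ x y, Φ (L x) (1 ⊗ₜ y) = 1 ⊗ₜ (x * y) := by
    intro x
    have hx : x ∈ Algebra.adjoin K {x | ∃ i j, i ≠ j ∧ x = br i j} := by
      rw [hbr]; trivial
    induction hx using Algebra.adjoin_induction with
    | mem x hx =>
      obtain ⟨i, j, -, rfl⟩ := hx
      intro y
      rw [hΦ, twistedBr_tmul, map_one]
    | algebraMap r =>
      intro y
      rw [AlgHom.commutes, AlgHom.commutes, ← Algebra.smul_def, tmul_smul]
      rfl
    | add x z _ _ hx hz =>
      intro y
      rw [map_add, map_add, LinearMap.add_apply, hx, hz, add_mul, tmul_add]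
    | mul x z _ _ hx hz =>
      intro y
      rw [map_mul, map_mul, Module.End.mul_apply, hz, hx, mul_assoc]
  intro x x' h
  have h1 := key x 1
  rw [h, key x' 1, mul_one, mul_one] at h1
  exact (Algebra.TensorProduct.includeRight_injective
    (algebraMap K (M)).injective h1).symm

/-- `hlift` is the part of the universal property of `X` that is needed; it is tested on the
endomorphisms of `M ⊗ A`, with `M` acting by multiplication. -/
theorem injective_of_exists_lift [Nontrivial M] (h : IsFKFamily p br)
    (hs : ∀ σ τ f, s σ (s τ f) = s (σ * τ) f) (hs1 : ∀ f, s 1 f = f)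
    (hbr : Algebra.adjoin K {x | ∃ i j, i ≠ j ∧ x = br i j} = ⊤) (L : A →ₐ[K] X)
    (hlift : ∀ (B : Type (max v w)) [Ring B] [Algebra K B] (F : M →ₐ[K] B) (br' : ι → ι → B),
      IsFKFamily p br' → (∀ i j, i ≠ j → ∀ f, br' i j * F f = F (s (Equiv.swap i j) f) * br' i j) →
      ∃ Φ : X →ₐ[K] B, ∀ i j, Φ (L (br i j)) = br' i j) : Function.Injective L := by
  obtain ⟨Φ, hΦ⟩ := hlift (Module.End K (M ⊗[K] A)) (mulLeftTensor K M A) (twistedBr s br)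
    (h.twistedBr s hs hs1)
    fun i j _ => twistedBr_mul_mulLeftTensor s i j
  exact injective_of_twistedBr s hbr L Φ hΦ

end twisted

variable {n : ℕ}

theorem TildeE.lift_injective (a : ℂ) (p : Fin n → Fin n → ℂ) :
    Function.Injective (TildeE.isFKFamily a p).lift := by
  refine injective_of_exists_lift (M := Mero n) (fun σ => meroPerm (n := n) σ) (isFKFamily_br p)
    (fun σ τ f => meroPerm_mul (n := n) σ τ f) (fun f => meroPerm_one (n := n) f)
    (FKAlg.adjoin_br p) _ fun B _ _ F br' h tw => ?_
  obtain ⟨Φ, hΦ⟩ := TildeE.exists_lift a p F h tw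
  refine ⟨Φ, fun i j => ?_⟩
  rw [IsFKFamily.lift_br, hΦ]

/-- The brackets generate a copy of `𝓔ₙᵖ` in the limit algebra. -/
theorem TildeE.exists_equiv (a : ℂ) (p : Fin n → Fin n → ℂ) :
    ∃ e : FKAlg p ≃ₐ[ℂ] Algebra.adjoin ℂ
        {x | ∃ i j, i ≠ j ∧ x = TildeE.br a (constPsi (a ^ 2) p) i j},
      ∀ i j, (e (FKAlg.br p i j) : TildeE a (constPsi (a ^ 2) p)) =
        TildeE.br a (constPsi (a ^ 2) p) i j := by
  have hr : (TildeE.isFKFamily a p).lift.range = Algebra.adjoin ℂ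
      {x | ∃ i j, i ≠ j ∧ x = TildeE.br a (constPsi (a ^ 2) p) i j} := by
    rw [← Algebra.map_top, ← FKAlg.adjoin_br, AlgHom.map_adjoin]
    congr 1
    ext x
    constructor
    · rintro ⟨_, ⟨i, j, hij, rfl⟩, rfl⟩
      exact ⟨i, j, hij, IsFKFamily.lift_br _ i j⟩
    · rintro ⟨i, j, hij, rfl⟩
      exact ⟨_, ⟨i, j, hij, rfl⟩, IsFKFamily.lift_br _ i j⟩
  exact ⟨(AlgEquiv.ofInjective _ (TildeE.lift_injective a p)).trans (Subalgebra.equivOfEq _ _ hr),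
    fun i j => IsFKFamily.lift_br (TildeE.isFKFamily a p) i j⟩

end limit

/-! ### The limit of the rational family and the conclusion -/

theorem tendsto_rationalPsi {n : ℕ} (A κ : ℂ) {Λ : Fin n → ℂ} (i j : Fin n) (z : ℂ) :
    Tendsto (fun δ : ℂ => (rationalPsi A (κ * δ ^ 2) (fun l => δ * Λ l) i j).1 z)
      (𝓝[≠] 0) (𝓝 ((constPsi A (limParam κ Λ) i j).1 z)) := by
  have h1 : Tendsto (fun δ : ℂ => (A - κ * δ ^ 2) / z ^ 2 + κ / (Λ i - Λ j) ^ 2) (𝓝[≠] 0)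
      (𝓝 (A / z ^ 2 + κ / (Λ i - Λ j) ^ 2)) := by
    have hc : Continuous fun δ : ℂ => (A - κ * δ ^ 2) / z ^ 2 + κ / (Λ i - Λ j) ^ 2 := by
      fun_prop
    have := (hc.tendsto 0).mono_left (nhdsWithin_le_nhds (s := {0}ᶜ))
    simpa using this
  -- For `δ ≠ 0` the powers of `δ` cancel in `K / λᵢⱼ²`, leaving the constant `κ / Λᵢⱼ²`; only `(A -
  -- K) / z²` still depends on `δ`.
  refine h1.congr' ?_
  filter_upwards [self_mem_nhdsWithin] with δ hδ
  change _ = (A - κ * δ ^ 2) / z ^ 2 + κ * δ ^ 2 / (δ * Λ i - δ * Λ j) ^ 2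
  congr 1
  rw [← mul_sub, mul_pow, mul_comm κ, mul_div_mul_left _ _ (pow_ne_zero 2 hδ)]

theorem proposition4p2 (n : ℕ) :
    (∀ (a κ : ℂ) (Λ : Fin n → ℂ), Function.Injective Λ →
      -- with `K = κ δ²` and `λᵢⱼ = δ Λᵢⱼ`, the functions `ψᵢⱼ(z)` converge to `A / z² + pᵢⱼ`
      (∀ i j, i ≠ j → ∀ z : ℂ, z ≠ 0 →
        Tendsto (fun δ : ℂ => (rationalPsi (a ^ 2) (κ * δ ^ 2) (fun l => δ * Λ l) i j).1 z)
          (𝓝[≠] 0) (𝓝 ((constPsi (a ^ 2) (limParam κ Λ) i j).1 z))) ∧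
      -- in the limit algebra `[ij]²` is the scalar `pᵢⱼ`, and the brackets generate `𝓔ₙᵖ`
      (∀ i j, i ≠ j → TildeE.br a (constPsi (a ^ 2) (limParam κ Λ)) i j ^ 2 =
        algebraMap ℂ _ (limParam κ Λ i j)) ∧
      (∃ e : FKAlg (limParam κ Λ) ≃ₐ[ℂ] Algebra.adjoin ℂ
            {x | ∃ i j, i ≠ j ∧ x = TildeE.br a (constPsi (a ^ 2) (limParam κ Λ)) i j},
        ∀ i j, i ≠ j →
          (e (FKAlg.br (limParam κ Λ) i j) : TildeE a (constPsi (a ^ 2) (limParam κ Λ))) =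
            TildeE.br a (constPsi (a ^ 2) (limParam κ Λ)) i j) ∧
      -- the Dunkl elements of the limit algebra commute and satisfy the formula
      (∀ i j, Commute (dunkl (TildeE.br a (constPsi (a ^ 2) (limParam κ Λ))) i)
        (dunkl (TildeE.br a (constPsi (a ^ 2) (limParam κ Λ))) j)) ∧
      (∀ (I : Finset (Fin n)) (k : ℕ),
        pElem (limParam κ Λ) (dunkl (TildeE.br a (constPsi (a ^ 2) (limParam κ Λ)))) k I =
          pieriSum (TildeE.br a (constPsi (a ^ 2) (limParam κ Λ))) k I)) ∧
    -- the Fomin–Kirillov conjecture: the formula in `𝓔ₙᵖ` for arbitrary parameters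
    (∀ (R : Type*) [CommRing R] (p : Fin n → Fin n → R), (∀ i j, p i j = p j i) →
      (∀ i j, Commute (dunkl (FKAlg.br p) i) (dunkl (FKAlg.br p) j)) ∧
      (∀ (I : Finset (Fin n)) (k : ℕ),
        pElem p (dunkl (FKAlg.br p)) k I = pieriSum (FKAlg.br p) k I)) := by
  refine ⟨fun a κ Λ _ => ?_, fun R _ p _ => ?_⟩
  · have h := TildeE.isFKFamily a (limParam κ Λ)
    obtain ⟨e, he⟩ := TildeE.exists_equiv a (limParam κ Λ)
    exact ⟨fun i j _ z _ => tendsto_rationalPsi (a ^ 2) κ i j z,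
      fun i j hij => (pow_two _).trans (h.sq i j hij), ⟨e, fun i j _ => he i j⟩,
      h.dunkl_commute, h.pElem_eq_pieriSum⟩
  · have h := isFKFamily_br p
    exact ⟨h.dunkl_commute, h.pElem_eq_pieriSum⟩
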